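/- **Setting.** Let $n\ge 1$, $[n]=\{1,\dots,n\}$ and $[[n]]=\{1,\bar 1,\dots,n,\bar n\}$ with the involution $i\leftrightarrow\bar i$; for $R\subseteq[[n]]$ put $\overline R=\{\bar x\mid x\in R\}$. Let $\Sigma$ be a finite totally ordered set of signs with a distinguished element $\bar\sigma$, and let $m=|\Sigma|\ge 1$. A *$\Sigma$-labeled partition* $x$ of $[[n]]$ is a partition of $[[n]]$, together with an injective assignment of signs in $\Sigma$ to some of its blocks (the *signed* blocks), such that $\overline R\in x$ for every block $R\in x$, and $R=\overline R$ if and only if $R$ is signed. Write $x_\sigma$ for the block of sign $\sigma$ ($x_\sigma=\emptyset$ if there is none) and $\Sigma(x)=\{\sigma\mid x_\sigma\neq\emptyset\}$. Put $x\preceq y$ if every block of $x$ is contained in a block of $y$ and $x_\sigma\subseteq y_\sigma$ for all $\sigma\in\Sigma$. Let $\Pi_{n,\Sigma}$ be the poset of all $\Sigma$-labeled partitions of $[[n]]$ with a new top element $\hat 1$ added; its bottom element $\hat 0$ is the partition of $[[n]]$ into singletons. The subposet of type $C_n$ is $\Pi_{n,\Sigma}$; the subposet of type $D_n$ consists of $\hat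 1$ and all $x$ with $|x_\sigma|\ne 2$ for all $\sigma\in\Sigma$; the subposet of type $B_n$ consists of $\hat 1$ and all $x$ with $|x_\sigma|\neq 2$ for all $\sigma\neq\bar\sigma$. The *representative* of a block $R$ is the least $i\in[n]$ with $i\in R$ or $\bar i\in R$; $R$ is *normalized* if it contains its representative. Label the edges $x\prec\!\cdot\, y$ of the Hasse diagram of $\Pi_{n,\Sigma}$ by elements of $\mathbb N\times\mathbb N$, ordered lexicographically, as follows. * If $y=\hat 1$, then $\lambda(x,y)=(1,2)$. * If $x_\sigma\subsetneq y_\sigma$ for some $\sigma\in\Sigma$, then $\lambda(x,y)=(1,|\{\tau\in\Sigma(x)\mid\tau\le\sigma\}|)$ if $\sigma\in\Sigma(x)$, and $\lambda(x,y)=(1,|\{\tau\in\Sigma\mid\tau\le\sigma\}\cup\Sigma(x)|)$ otherwise. * If there are distinct normalized unsigned blocks $R,R'$ of $x$, with representatives $i,j$, such that $R\cup R'\in y$, then $\lambda(x,y)=(0,\max(i,j))$. * If there are distinct normalized unsigned blocks $R,R'$ of $x$, with representatives $i,j$, such that $R\cup\overline{R'}\in y$, then $\lambda(x,y)=(2,\min(i,j))$.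 Exactly one of these cases applies to each edge. A maximal chain $\hat 0=x_0\prec\!\cdot\,x_1\prec\!\cdot\cdots\prec\!\cdot\,x_t=\hat 1$ of one of the subposets is *decreasing* if its word of labels $\lambda(x_0,x_1)\,\lambda(x_1,x_2)\cdots\lambda(x_{t-1},x_t)$ is weakly decreasing. **Theorem.** Assume $n\ge 1$ in type $C_n$, and $n\geq 2$ in types $B_n$ and $D_n$. Then, for every total order on $\Sigma$ and every choice of $\bar\sigma$, the number of decreasing maximal chains from $\hat 0$ to $\hat 1$ in the subposet of $\Pi_{n,\Sigma}$ of type $B_n$, $C_n$ or $D_n$ is $$\sum_{\pi=\pi_1|\cdots|\pi_k\,\in\,\Pi_n} f(\pi)\cdot(2|\pi_1|-3)!!\cdots(2|\pi_k|-3)!!,$$ where $\Pi_n$ is the set of partitions of $[n]$, $(-1)!!=1$, and $f(\pi)$ is defined as follows in terms of the type, of $m$, of the number $k$ of blocks of $\pi$ and of the number $s$ of nonsingleton blocks of $\pi$. * Type $C_n$: $f(\pi)=\dfrac{(k+m-2)!}{(m-2)!}$ if $m\ge 2$, and $f(\pi)=0$ if $m=1$. * Type $D_n$: $f(\pi)=m-1$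 if $k=1$ (that is, $\pi=[n]$), and otherwise $$f(\pi)=\sum_{r=2}^{\min(m,s)}\binom mr\frac{(k-2)!}{(r-2)!}\frac{s!}{(s-r)!}.$$ * Type $B_n$: $f(\pi)=m-1$ if $k=1$, and otherwise $$f(\pi)=\sum_{r=2}^{\min(m,s+1)}\binom{m-1}{r-1}\frac{(k-2)!}{(r-2)!}(k-r+1)\frac{s!}{(s-r+1)!}+\sum_{r=2}^{\min(m-1,s)}\binom{m-1}{r}\frac{(k-2)!}{(r-2)!}\frac{s!}{(s-r)!}.$$ -/

import Mathlib

/-- The set `[[n]] = {1, 1̄, …, n, n̄}`: the pair `(i, false)` stands for the element `i + 1` of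
`{1, …, n}` and `(i, true)` for its barred copy. -/
abbrev BarSet (n : ℕ) : Type := Fin n × Bool

/-- The involution `R ↦ R̄` on subsets of `[[n]]`. -/
def barImage {n : ℕ} (R : Finset (BarSet n)) : Finset (BarSet n) :=
  R.image (fun a => (a.1, !a.2))

/-- A `S`-labeled partition of `[[n]]`: a partition `part` of `[[n]]` some of whose blocks carry
pairwise distinct signs in `S`. The partial injection from blocks to signs is recorded by its
inverse: `signed σ` is the block of sign `σ` if there is one, and `∅` otherwise. -/
@[ext]
structure SignedPartition (n : ℕ) (S : Type*) where
  part : Finpartition (Finset.univ : Finset (BarSet n))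
  signed : S → Finset (BarSet n)
  signed_mem : ∀ σ, (signed σ).Nonempty → signed σ ∈ part.parts
  signed_inj : ∀ σ τ, (signed σ).Nonempty → signed σ = signed τ → σ = τ
  bar_mem : ∀ R ∈ part.parts, barImage R ∈ part.parts
  bar_eq_iff : ∀ R ∈ part.parts, barImage R = R ↔ ∃ σ, signed σ = R

namespace SignedPartition

variable {n : ℕ} {S : Type*}

/-- Refinement: every block of `x` lies in a block of `y`, and the block of `x` of sign `σ`
(if any) lies in the block of `y` of the same sign `σ`. -/
instance : PartialOrder (SignedPartition n S) where
  le x y := x.part ≤ y.part ∧ ∀ σ, x.signed σ ⊆ y.signed σ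
  le_refl x := ⟨le_refl _, fun _ => Finset.Subset.refl _⟩
  le_trans x y z hxy hyz :=
    ⟨hxy.1.trans hyz.1, fun σ => Finset.Subset.trans (hxy.2 σ) (hyz.2 σ)⟩
  le_antisymm x y hxy hyx :=
    SignedPartition.ext (le_antisymm hxy.1 hyx.1)
      (funext fun σ => Finset.Subset.antisymm (hxy.2 σ) (hyx.2 σ))

/-- The finest labeled partition `1 | 1̄ | ⋯ | n | n̄`, with no signed block, is the bottom. -/
instance : OrderBot (SignedPartition n S) where
  bot :=
    { part := ⊥
      signed := fun _ => ∅
      signed_mem := fun _ h => absurd h Finset.not_nonempty_empty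
      signed_inj := fun _ _ h _ => absurd h Finset.not_nonempty_empty
      bar_mem := by
        intro R hR
        obtain ⟨a, -, rfl⟩ := Finpartition.mem_bot_iff.1 hR
        exact Finpartition.mem_bot_iff.2 ⟨(a.1, !a.2), Finset.mem_univ _, by simp [barImage]⟩
      bar_eq_iff := by
        intro R hR
        obtain ⟨a, -, rfl⟩ := Finpartition.mem_bot_iff.1 hR
        constructor
        · intro h
          have h2 := congrArg Prod.snd (Finset.singleton_injective
            (show ({(a.1, !a.2)} : Finset (BarSet n)) = {a} by simpa [barImage] using h))
          simp at h2
        · rintro ⟨σ, h⟩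
          exact absurd h.symm (Finset.singleton_ne_empty a) }
  bot_le x := ⟨bot_le, fun _ => Finset.empty_subset _⟩

/-- `R` is an unsigned block of `x`. -/
def IsUnsignedBlock (x : SignedPartition n S) (R : Finset (BarSet n)) : Prop :=
  R ∈ x.part.parts ∧ ∀ σ, x.signed σ ≠ R

/-- The set of signs `Σ(x)` of the signed blocks of `x`. -/
noncomputable def signs [Fintype S] (x : SignedPartition n S) : Finset S :=
  {σ | (x.signed σ).Nonempty}

end SignedPartition

/-- The poset `Π_{n,S}`: all `S`-labeled partitions of `[[n]]` together with a new top element. -/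
abbrev LabeledPartitionPoset (n : ℕ) (S : Type*) : Type _ := WithTop (SignedPartition n S)

/-- The representative of a nonempty block `R`: the least `i ∈ {1, …, n}` such that `i ∈ R` or
`ī ∈ R`. -/
noncomputable def representative {n : ℕ} (R : Finset (BarSet n)) : ℕ :=
  sInf {i : ℕ | ∃ a ∈ R, (a.1 : ℕ) + 1 = i}

/-- A block is normalized if it contains its representative (unbarred). -/
def IsNormalized {n : ℕ} (R : Finset (BarSet n)) : Prop :=
  ∃ i : Fin n, (i, false) ∈ R ∧ (i : ℕ) + 1 = representative R

section Labeling

variable {n : ℕ} {S : Type*}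

/-- `R` and `R'` are distinct normalized unsigned blocks of `x`. -/
def IsNormalizedPair (x : SignedPartition n S)
    (p : Finset (BarSet n) × Finset (BarSet n)) : Prop :=
  p.1 ≠ p.2 ∧ x.IsUnsignedBlock p.1 ∧ IsNormalized p.1 ∧ x.IsUnsignedBlock p.2 ∧ IsNormalized p.2

/-- `p = (R, R')` witnesses that the edge from `x` to `y` is coherent: `R ∪ R'` is a block
of `y`. -/
def IsCoherentPair (x y : SignedPartition n S)
    (p : Finset (BarSet n) × Finset (BarSet n)) : Prop :=
  IsNormalizedPair x p ∧ p.1 ∪ p.2 ∈ y.part.parts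

/-- `p = (R, R')` witnesses that the edge from `x` to `y` is non-coherent: `R ∪ R̄'` is a block
of `y`. -/
def IsNonCoherentPair (x y : SignedPartition n S)
    (p : Finset (BarSet n) × Finset (BarSet n)) : Prop :=
  IsNormalizedPair x p ∧ p.1 ∪ barImage p.2 ∈ y.part.parts

open Classical in
/-- The second component of the label of an edge of sign `σ` starting at `x`. -/
noncomputable def signLabel [Fintype S] [LinearOrder S] (x : SignedPartition n S) (σ : S) : ℕ :=
  if σ ∈ x.signs then (x.signs.filter (· ≤ σ)).card
  else ((Finset.univ.filter (· ≤ σ)) ∪ x.signs).card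

open Classical in
/-- The edge labeling `λ` of `Π_{n,S}`, with values in `ℕ × ℕ` ordered lexicographically. Only its
values at cover relations matter; there exactly one of the first four cases occurs, and the chosen
sign (or the chosen pair of blocks, up to order) is unique. -/
noncomputable def edgeLabel [Fintype S] [LinearOrder S] :
    LabeledPartitionPoset n S → LabeledPartitionPoset n S → ℕ ×ₗ ℕ
  | _, ⊤ => toLex (1, 2)
  | (x : SignedPartition n S), (y : SignedPartition n S) =>
    if h : ∃ σ, x.signed σ ⊂ y.signed σ then
      toLex (1, signLabel x h.choose)
    else if h : ∃ p, IsCoherentPair x y p then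
      toLex (0, max (representative h.choose.1) (representative h.choose.2))
    else if h : ∃ p, IsNonCoherentPair x y p then
      toLex (2, min (representative h.choose.1) (representative h.choose.2))
    else toLex (0, 0)
  | ⊤, (_ : SignedPartition n S) => toLex (0, 0)

end Labeling

/-- The three types of subposets. -/
inductive PartitionType
  | B
  | C
  | D

/-- The condition that cuts out the labeled partitions of a given type, where `σ₀` is the
distinguished sign: in type `C` there is no condition, in type `D` no signed block has two elements,
and in type `B` no signed block of a sign other than `σ₀` has two elements. -/
def IsOfType {n : ℕ} {S : Type*} (t : PartitionType) (σ₀ : S) (x : SignedPartition n S) : Prop :=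
  match t with
  | .B => ∀ σ, σ ≠ σ₀ → (x.signed σ).card ≠ 2
  | .C => True
  | .D => ∀ σ, (x.signed σ).card ≠ 2

/-- The subposet of `Π_{n,S}` of type `B`, `C` or `D`; it contains the top element. -/
abbrev TypeSubposet (n : ℕ) {S : Type*} (t : PartitionType) (σ₀ : S) : Type _ :=
  {X : LabeledPartitionPoset n S // ∀ x : SignedPartition n S, X = x → IsOfType t σ₀ x}

instance {n : ℕ} {S : Type*} (t : PartitionType) (σ₀ : S) :
    BoundedOrder (TypeSubposet n t σ₀) where
  top := ⟨⊤, fun _ h => absurd h.symm (WithTop.coe_ne_top)⟩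
  le_top X := (le_top : X.1 ≤ ⊤)
  bot := ⟨⊥, fun x h => by
    obtain rfl : (⊥ : SignedPartition n S) = x := WithTop.coe_injective h
    cases t
    · exact fun σ _ => (by decide : (0 : ℕ) ≠ 2)
    · trivial
    · exact fun σ => (by decide : (0 : ℕ) ≠ 2)⟩
  bot_le X := (bot_le : ⊥ ≤ X.1)

/-- The word of edge labels along a sequence of elements. -/
noncomputable def labelWord {n : ℕ} {S : Type*} [Fintype S] [LinearOrder S]
    (c : List (LabeledPartitionPoset n S)) : List (ℕ ×ₗ ℕ) :=
  List.zipWith edgeLabel c c.tail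

/-- The set of maximal chains `0̂ ⋖ x₁ ⋖ ⋯ ⋖ 1̂` of the subposet whose word of edge labels is
weakly decreasing. -/
def decreasingMaximalChains (n : ℕ) {S : Type*} [Fintype S] [LinearOrder S]
    (t : PartitionType) (σ₀ : S) : Set (List (TypeSubposet n t σ₀)) :=
  {c | c.head? = some ⊥ ∧ c.getLast? = some ⊤ ∧ c.IsChain (· ⋖ ·) ∧
    (labelWord (c.map Subtype.val)).IsChain (· ≥ ·)}

/-- The function `f(π)` of the type, of `m = |Σ|`, of the number `k` of blocks of `π` and of the
number `s` of nonsingleton blocks of `π`. The case `k = 1` is `π = [n]`. Since `s ≤ k`, every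
quotient below is exact, except in the term `r = k + 1` of type `B`, whose factor `k - r + 1`
vanishes. -/
def chainCoeff (t : PartitionType) (m k s : ℕ) : ℕ :=
  match t with
  | .C => if m = 1 then 0 else (k + m - 2).factorial / (m - 2).factorial
  | .D =>
    if k = 1 then m - 1
    else ∑ r ∈ Finset.Icc 2 (min m s),
      m.choose r * ((k - 2).factorial / (r - 2).factorial) * (s.factorial / (s - r).factorial)
  | .B =>
    if k = 1 then m - 1
    else
      (∑ r ∈ Finset.Icc 2 (min m (s + 1)),
        (m - 1).choose (r - 1) * ((k - 2).factorial / (r - 2).factorial) * (k + 1 - r) *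
          (s.factorial / (s + 1 - r).factorial)) +
      ∑ r ∈ Finset.Icc 2 (min (m - 1) s),
        (m - 1).choose r * ((k - 2).factorial / (r - 2).factorial) *
          (s.factorial / (s - r).factorial)

/-! A weakly decreasing label word ends with the label `(1, 2)` of the edge to the top. Hence
coherent merges, whose labels begin with 0, never occur, and a decreasing chain has two phases:
non-coherent merges with labels `(2, r)`, then sign edges with labels `(1, b)`, `b ≥ 2`.

Sign phase. Start with `k` unsigned blocks, `s` of them nonsingleton, and no signs. The label of a
new sign exceeds the number of signs present, while a present sign is labeled by its rank among
them. So a decreasing word first introduces all the signs that it will use, from the largest to the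
smallest, and then only uses ranks. For a set `R` of `r` signs there are `blockWays` choices of the
blocks that introduce them. The other `k - r` blocks come in any order, with a weakly decreasing
word in `{2, …, r}`: this gives `(k - r)! * (k - 2).choose (k - r)`. The sum over `R` is
`signPhaseCount`. It depends only on `k` and `s` and equals `f` (`signPhaseCount_eq_chainCoeff`).
For `k = 1` the only sign edge must itself have label at least `(1, 2)`, which excludes just the
least sign.

Merge phase. Decreasing labels `(2, r)` mean that, for `r = n, …, 1` in turn, the block of `r`,
still a singleton, absorbs some of the later blocks in some order. One such stage acts on functions
of the number of blocks and of nonsingleton blocks as `stageOp`. So the number of chains is the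
result of `n` stages applied to `signPhaseCount` (`IsFresh.hasCount_stagesOp`).

The chains are not sorted by the partition `π`. Instead, the weighted sum over partitions is shown
to obey the same recursion: adjoining an element to a block of size `b` multiplies its double
factorial by `2 * b - 1`, which yields `adjoinOp`, and this operator commutes with stages up to a
shift of its parameter (`adjoinOp_stageOp`). This gives `partitionSum_eq_stagesOp`.

On the side of the poset, labeled partitions are replaced by canonical code functions on `[n]`.
Every strict refinement factors through an elementary move, and a move removes exactly one
representative of an unsigned block, so covers are the same as moves; this makes the recursion for
chains explicit (`IsSubposetCode.chainCount_eq`). -/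

/-! ### Sums over set partitions weighted by double factorials. -/

section PartitionSums

open Finset

variable {α : Type*} [DecidableEq α]

/-- Adjoin a new element `a` to the block `P` of a partition, or as a singleton if `P = ∅`. -/
def Finpartition.adjoin {s : Finset α} (π : Finpartition s) {a : α} (ha : a ∉ s) (P : Finset α)
    (hP : P ∈ insert ∅ π.parts) : Finpartition (insert a s) :=
  Finpartition.ofExistsUnique (insert (insert a P) (π.parts.erase P))
    (by
      have hPs : P ⊆ s := by
        rcases mem_insert.1 hP with rfl | h
        · exact empty_subset _
        · exact π.subset h
      intro p hp
      rcases mem_insert.1 hp with rfl | h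
      · exact insert_subset_insert _ hPs
      · exact (π.subset (mem_of_mem_erase h)).trans (subset_insert _ _))
    (by
      intro b hb
      by_cases hbP : b = a ∨ b ∈ P
      · refine ⟨insert a P, ⟨mem_insert_self _ _, by simpa using hbP⟩, ?_⟩
        rintro t ⟨ht, hbt⟩
        rcases mem_insert.1 ht with rfl | h
        · rfl
        · obtain ⟨h1, h2⟩ := mem_erase.1 h
          rcases hbP with rfl | hbP
          · exact absurd (π.subset h2 hbt) ha
          · rcases mem_insert.1 hP with rfl | hP
            · simp at hbP
            · exact absurd (π.eq_of_mem_parts h2 hP hbt hbP) h1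
      · push Not at hbP
        have hbs : b ∈ s := (mem_insert.1 hb).resolve_left hbP.1
        obtain ⟨t, ⟨ht, hbt⟩, hu⟩ := π.existsUnique_mem hbs
        refine ⟨t, ⟨mem_insert_of_mem (mem_erase.2 ⟨?_, ht⟩), hbt⟩, ?_⟩
        · rintro rfl
          exact hbP.2 hbt
        · rintro u ⟨hu1, hu2⟩
          rcases mem_insert.1 hu1 with rfl | h
          · simp [hbP.1, hbP.2] at hu2
          · exact hu u ⟨mem_of_mem_erase h, hu2⟩)
    (by
      intro h
      rcases mem_insert.1 h with h | h
      · exact (insert_ne_empty _ _ h.symm)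
      · exact π.empty_notMem_parts (mem_of_mem_erase h))

lemma Finpartition.parts_adjoin {s : Finset α} (π : Finpartition s) {a : α} (ha : a ∉ s)
    (P : Finset α) (hP : P ∈ insert ∅ π.parts) :
    (π.adjoin ha P hP).parts = insert (insert a P) (π.parts.erase P) := rfl

lemma Finpartition.notMem_of_mem_insert_empty {s : Finset α} (π : Finpartition s) {a : α}
    (ha : a ∉ s) {P : Finset α} (hP : P ∈ insert ∅ π.parts) : a ∉ P := by
  rcases mem_insert.1 hP with rfl | h
  · simp
  · exact fun h' => ha (π.subset h h')

/-- The inverse deletes `a` from its block; the rest of that block is the marked set `P`, with `∅`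
when `a` was a singleton. -/
lemma Finpartition.adjoin_bijective {s : Finset α} {a : α} (ha : a ∉ s) :
    Function.Bijective (fun p : (Σ π : Finpartition s, {P // P ∈ insert ∅ π.parts}) =>
      p.1.adjoin ha p.2.1 p.2.2) := by
  constructor
  · rintro ⟨π, P, hP⟩ ⟨ρ, Q, hQ⟩ h
    have h' : insert (insert a P) (π.parts.erase P) = insert (insert a Q) (ρ.parts.erase Q) :=
      congrArg Finpartition.parts h
    have haP := π.notMem_of_mem_insert_empty ha hP
    have haQ := ρ.notMem_of_mem_insert_empty ha hQ
    have h1 : insert a P = insert a Q := by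
      have : insert a P ∈ insert (insert a Q) (ρ.parts.erase Q) := h' ▸ mem_insert_self _ _
      rcases mem_insert.1 this with h | h
      · exact h
      · exact absurd (ρ.subset (mem_of_mem_erase h) (mem_insert_self a P)) ha
    have h2 : P = Q := by
      rw [← erase_insert haP, h1, erase_insert haQ]
    subst h2
    -- Recovers `π` from the enlarged partition; the last `erase ∅` covers the case `P = ∅`.
    have key : ∀ (π : Finpartition s), P ∈ insert ∅ π.parts →
        π.parts = (insert P ((insert (insert a P) (π.parts.erase P)).erase (insert a P))).erase ∅ := by
      intro π hP
      rw [erase_insert]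
      · rcases mem_insert.1 hP with rfl | h
        · rw [erase_insert_eq_erase, erase_idem, erase_eq_of_notMem π.empty_notMem_parts]
        · rw [insert_erase h, erase_eq_of_notMem π.empty_notMem_parts]
      · intro h
        exact ha (π.subset (mem_of_mem_erase h) (mem_insert_self _ _))
    have h3 : π = ρ := by
      apply Finpartition.ext
      rw [key π hP, key ρ hQ, h']
    subst h3
    rfl
  · intro Q
    have hs : insert a s \ {a} = s := by
      rw [sdiff_singleton_eq_erase, erase_insert ha]
    have haQ : a ∈ Q.part a := Q.mem_part_self.2 (mem_insert_self _ _)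
    have hmQ : Q.part a ∈ Q.parts := Q.part_mem.2 (mem_insert_self _ _)
    have hsub : ∀ c ∈ Q.parts, c ≠ Q.part a → a ∉ c := fun c hc hne hac =>
      hne (Q.eq_of_mem_parts hc hmQ hac haQ)
    have hP : (Q.part a).erase a ∈ insert ∅ ((Q.avoid {a}).copy hs).parts := by
      by_cases h : (Q.part a).erase a = ∅
      · rw [h]; exact mem_insert_self _ _
      · refine mem_insert_of_mem ((Q.mem_avoid).2 ⟨Q.part a, hmQ, ?_, sdiff_singleton_eq_erase _ _⟩)
        intro h'
        apply h
        rw [← sdiff_singleton_eq_erase]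
        exact sdiff_eq_empty_iff_subset.2 h'
    refine ⟨⟨(Q.avoid {a}).copy hs, (Q.part a).erase a, hP⟩, ?_⟩
    apply Finpartition.ext
    change insert (insert a ((Q.part a).erase a)) ((Q.avoid {a}).parts.erase _) = Q.parts
    rw [insert_erase haQ]
    ext c
    rw [mem_insert, mem_erase, Q.mem_avoid]
    constructor
    · rintro (rfl | ⟨hc, d, hd, hda, rfl⟩)
      · exact hmQ
      · have had : a ∉ d := hsub d hd (by
          rintro rfl
          exact hc (sdiff_singleton_eq_erase _ _))
        rwa [sdiff_singleton_eq_erase, erase_eq_of_notMem had]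
    · intro hc
      by_cases hca : c = Q.part a
      · exact Or.inl hca
      · have hac := hsub c hc hca
        obtain ⟨b, hb⟩ := Q.nonempty_of_mem_parts hc
        refine Or.inr ⟨?_, c, hc, ?_, ?_⟩
        · intro h
          rw [h] at hb
          exact hca (Q.eq_of_mem_parts hc hmQ (h ▸ hb) (mem_of_mem_erase hb))
        · intro h
          exact hac (mem_singleton.1 (h hb) ▸ hb)
        · rw [sdiff_singleton_eq_erase, erase_eq_of_notMem hac]

/-- The number of nonsingleton blocks. -/
def Finpartition.nonsingletons {s : Finset α} (π : Finpartition s) : Finset (Finset α) :=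
  π.parts.filter (fun P => P.card ≠ 1)

/-- The product of the numbers `(2|P| - 3)!!` over the blocks `P`. -/
def Finpartition.doubleFactorialWeight {s : Finset α} (π : Finpartition s) : ℕ :=
  ∏ P ∈ π.parts, Nat.doubleFactorial (2 * P.card - 3)

/-- The sum of `f k s` over all partitions, with `k` blocks and `s` nonsingleton blocks,
weighted by double factorials. -/
def partitionSum (s : Finset α) (f : ℕ → ℕ → ℤ) : ℤ :=
  ∑ π : Finpartition s, f π.parts.card π.nonsingletons.card * π.doubleFactorialWeight

/-- The effect on block counts of adjoining an element to a partition of an `N`-element set. -/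
def adjoinOp (N : ℕ) (f : ℕ → ℕ → ℤ) (k s : ℕ) : ℤ :=
  f (k + 1) s + ((k : ℤ) - s) * f k (s + 1) + (2 * ((N : ℤ) - k + s) - s) * f k s

lemma doubleFactorial_two_mul_succ_sub (b : ℕ) (hb : 1 ≤ b) :
    Nat.doubleFactorial (2 * (b + 1) - 3) = (2 * b - 1) * Nat.doubleFactorial (2 * b - 3) := by
  obtain ⟨c, rfl⟩ := Nat.exists_eq_add_of_le' hb
  cases c with
  | zero => rfl
  | succ c =>
    rw [show 2 * (c + 1 + 1 + 1) - 3 = (2 * c + 1) + 2 by omega,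
      Nat.doubleFactorial_add_two]
    congr 1

/-- The new element is a singleton, or joins one of the `k - s` singletons (weight factor 1), or
joins a nonsingleton block of size `b` (weight factor `2 * b - 1`). The nonsingleton blocks contain
`N - (k - s)` elements together, so their factors add up to `2 * (N - k + s) - s`. -/
lemma partitionSum_insert {s : Finset α} {a : α} (ha : a ∉ s) (f : ℕ → ℕ → ℤ) :
    partitionSum (insert a s) f = partitionSum s (adjoinOp s.card f) := by
  unfold partitionSum
  rw [← (Finpartition.adjoin_bijective ha).sum_comp, Fintype.sum_sigma]
  refine sum_congr rfl fun π _ => ?_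
  have hins : ∀ P ∈ insert ∅ π.parts, insert a P ∉ π.parts.erase P := fun P _ h =>
    ha (π.subset (mem_of_mem_erase h) (mem_insert_self _ _))
  have e1 : (f ((π.adjoin ha ∅ (mem_insert_self _ _)).parts.card)
      (π.adjoin ha ∅ (mem_insert_self _ _)).nonsingletons.card *
      (π.adjoin ha ∅ (mem_insert_self _ _)).doubleFactorialWeight : ℤ) =
      f (π.parts.card + 1) π.nonsingletons.card * π.doubleFactorialWeight := by
    have := hins ∅ (mem_insert_self _ _)
    simp only [Finpartition.nonsingletons, Finpartition.doubleFactorialWeight,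
      Finpartition.parts_adjoin]
    rw [card_insert_of_notMem this, prod_insert this, filter_insert,
      erase_eq_of_notMem π.empty_notMem_parts]
    simp
  have e2 : ∀ P (hP : P ∈ π.parts), (f ((π.adjoin ha P (mem_insert_of_mem hP)).parts.card)
      (π.adjoin ha P (mem_insert_of_mem hP)).nonsingletons.card *
      (π.adjoin ha P (mem_insert_of_mem hP)).doubleFactorialWeight : ℤ) =
      ((if P.card = 1 then f π.parts.card (π.nonsingletons.card + 1) else
        (2 * P.card - 1) * f π.parts.card π.nonsingletons.card)) * π.doubleFactorialWeight := by
    intro P hP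
    have h1 := hins P (mem_insert_of_mem hP)
    have haP : a ∉ P := π.notMem_of_mem_insert_empty ha (mem_insert_of_mem hP)
    have hpos : 1 ≤ P.card := card_pos.2 (π.nonempty_of_mem_parts hP)
    have hcard : (insert a P).card = P.card + 1 := card_insert_of_notMem haP
    have hw : ∀ x : ℕ, x + 1 ≠ 1 ↔ x ≠ 0 := by omega
    have hk : (insert (insert a P) (π.parts.erase P)).card = π.parts.card := by
      rw [card_insert_of_notMem h1, card_erase_add_one hP]
    have hs : ((insert (insert a P) (π.parts.erase P)).filter (fun P => P.card ≠ 1)).card =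
        (if P.card = 1 then π.nonsingletons.card + 1 else π.nonsingletons.card) := by
      rw [filter_insert, if_pos (by omega), card_insert_of_notMem (fun h => h1 (mem_filter.1 h).1),
        filter_erase, Finpartition.nonsingletons]
      split_ifs with h
      · rw [erase_eq_of_notMem (by simp [h])]
      · rw [card_erase_add_one (by simp [h, hP])]
    simp only [Finpartition.nonsingletons, Finpartition.doubleFactorialWeight,
      Finpartition.parts_adjoin] at hs ⊢
    rw [hk, hs, prod_insert h1, hcard, doubleFactorial_two_mul_succ_sub _ hpos, mul_assoc,
      mul_prod_erase _ (fun P : Finset α => Nat.doubleFactorial (2 * P.card - 3)) hP]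
    split_ifs with h
    · simp [h]
    · push_cast [Nat.cast_sub (show 1 ≤ 2 * P.card by omega)]
      ring
  -- A function of the bare set `P`, so that the sum over a subtype becomes a sum over `insert ∅
  -- π.parts`.
  set G : Finset α → ℤ := fun P => if P = ∅ then
      f (π.parts.card + 1) π.nonsingletons.card * π.doubleFactorialWeight else
      ((if P.card = 1 then f π.parts.card (π.nonsingletons.card + 1) else
        (2 * P.card - 1) * f π.parts.card π.nonsingletons.card)) * π.doubleFactorialWeight with hG
  have e3 : ∀ P : {P // P ∈ insert ∅ π.parts}, (f ((π.adjoin ha P.1 P.2).parts.card)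
      (π.adjoin ha P.1 P.2).nonsingletons.card *
      (π.adjoin ha P.1 P.2).doubleFactorialWeight : ℤ) = G P.1 := by
    rintro ⟨P, hP⟩
    by_cases h : P = ∅
    · subst h
      simpa [hG] using e1
    · simpa [hG, h] using e2 P ((mem_insert.1 hP).resolve_left h)
  rw [sum_congr rfl fun P _ => e3 P, sum_coe_sort (insert ∅ π.parts) G,
    sum_insert π.empty_notMem_parts]
  have e4 : ∑ P ∈ π.parts, G P = ∑ P ∈ π.parts,
      ((if P.card = 1 then f π.parts.card (π.nonsingletons.card + 1) else
        (2 * P.card - 1) * f π.parts.card π.nonsingletons.card)) * π.doubleFactorialWeight :=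
    sum_congr rfl fun P hP => if_neg (π.ne_empty hP)
  have hcount : (π.parts.filter (fun P => P.card = 1)).card + π.nonsingletons.card =
      π.parts.card := card_filter_add_card_filter_not _
  have hsum : ∑ P ∈ π.nonsingletons, (P.card : ℤ) =
      s.card - (π.parts.filter (fun P => P.card = 1)).card := by
    have h1 := π.sum_card_parts
    rw [← sum_filter_add_sum_filter_not π.parts (fun P => P.card = 1)] at h1
    rw [sum_congr rfl (fun P hP => (mem_filter.1 hP).2), sum_const, smul_eq_mul, mul_one] at h1
    rw [← h1, Finpartition.nonsingletons]
    push_cast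
    ring
  rw [e4, ← sum_mul, sum_ite, sum_const, ← sum_mul, sum_sub_distrib, ← mul_sum]
  change G ∅ + ((π.parts.filter (fun P => P.card = 1)).card • _ +
    (2 * (∑ P ∈ π.nonsingletons, (P.card : ℤ)) - ∑ P ∈ π.nonsingletons, 1) * _) * _ = _
  rw [hsum, ← hcount]
  simp only [hG, if_true, adjoinOp, sum_const, nsmul_eq_mul, ← hcount]
  push_cast
  ring

lemma partitionSum_empty (f : ℕ → ℕ → ℤ) : partitionSum (∅ : Finset α) f = f 0 0 := by
  have : (univ : Finset (Finpartition (∅ : Finset α))) = {Finpartition.empty (Finset α)} := by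
    ext π
    simp only [mem_univ, mem_singleton, true_iff]
    exact Subsingleton.elim (h := inferInstanceAs (Subsingleton (Finpartition (⊥ : Finset α)))) _ _
  rw [partitionSum, this, sum_singleton]
  simp [Finpartition.nonsingletons, Finpartition.doubleFactorialWeight, Finpartition.empty]

/-- The result of merging a nonsingleton block, in all possible orders, with some of `l` other
blocks, `s` of which are nonsingleton. -/
def mergeOp (f : ℕ → ℕ → ℤ) : ℕ → ℕ → ℤ
  | 0, s => f 1 (s + 1)
  | l + 1, s => f (l + 2) (s + 1) + s * mergeOp f l (s - 1) + ((l + 1 : ℤ) - s) * mergeOp f l s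

/-- The result of merging a singleton, in all possible orders, with some of `l` other
blocks, `s` of which are nonsingleton. -/
def stageOp (f : ℕ → ℕ → ℤ) (l s : ℕ) : ℤ := f (l + 1) s - f (l + 1) (s + 1) + mergeOp f l s

/-- `mergeOp` has one distinguished nonsingleton block that its arguments do not count; this shifts
the coefficients of `adjoinOp` and leaves the error term `2 * mergeOp f l s`. -/
lemma adjoinOp_mergeOp (N : ℕ) (f : ℕ → ℕ → ℤ) (l s : ℕ) (hs : s ≤ l) :
    adjoinOp N (mergeOp f) l s = mergeOp (adjoinOp N f) l s + 2 * mergeOp f l s := by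
  induction l generalizing s with
  | zero =>
    obtain rfl : s = 0 := by omega
    simp [adjoinOp, mergeOp]
    ring
  | succ l ih =>
    -- The induction hypothesis needs `s ≤ l`; in the remaining case `s = l + 1` the coefficient
    -- vanishes.
    have h1 : ((l + 1 : ℤ) - s) * (adjoinOp N (mergeOp f) l s) =
        ((l + 1 : ℤ) - s) * (mergeOp (adjoinOp N f) l s + 2 * mergeOp f l s) := by
      rcases Nat.lt_or_ge l s with h | h
      · obtain rfl : s = l + 1 := by omega
        simp
      · rw [ih s h]
    cases s with
    | zero =>
      simp only [adjoinOp, mergeOp] at h1 ⊢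
      push_cast at h1 ⊢
      linear_combination h1
    | succ s =>
      have h2 := ih s (by omega)
      simp only [adjoinOp, mergeOp, Nat.add_sub_cancel] at h1 h2 ⊢
      push_cast at h1 h2 ⊢
      linear_combination h1 + (s + 1 : ℤ) * h2

lemma mergeOp_add (f g : ℕ → ℕ → ℤ) (c : ℤ) (l s : ℕ) :
    mergeOp (fun k s => f k s + c * g k s) l s = mergeOp f l s + c * mergeOp g l s := by
  induction l generalizing s with
  | zero => rfl
  | succ l ih => simp only [mergeOp, ih]; ring

/-- Replacing `N` by `N + 1` adds `2 * f` to `adjoinOp N f`, and this absorbs the error term of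
`adjoinOp_mergeOp`. -/
lemma adjoinOp_stageOp (N : ℕ) (f : ℕ → ℕ → ℤ) (l s : ℕ) (hs : s ≤ l) :
    adjoinOp N (stageOp f) l s = stageOp (adjoinOp (N + 1) f) l s := by
  have h1 := adjoinOp_mergeOp N f l s hs
  have h2 : mergeOp (adjoinOp (N + 1) f) l s = mergeOp (adjoinOp N f) l s + 2 * mergeOp f l s := by
    rw [← mergeOp_add]
    congr 1
    funext k s
    simp only [adjoinOp]
    push_cast
    ring
  simp only [stageOp, h2]
  simp only [adjoinOp, stageOp] at h1 ⊢
  push_cast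
  linear_combination h1

/-- The effect of merging, from the last to the first, each of `q` singletons with later blocks. -/
def stagesOp (f : ℕ → ℕ → ℤ) : ℕ → ℕ → ℕ → ℤ
  | 0 => f
  | q + 1 => stageOp (stagesOp f q)

lemma mergeOp_congr (f g : ℕ → ℕ → ℤ) (h : ∀ k s, s ≤ k → f k s = g k s) (l s : ℕ) (hs : s ≤ l) :
    mergeOp f l s = mergeOp g l s := by
  induction l generalizing s with
  | zero => exact h _ _ (by omega)
  | succ l ih =>
    have h1 : ((l + 1 : ℤ) - s) * mergeOp f l s = ((l + 1 : ℤ) - s) * mergeOp g l s := by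
      rcases Nat.lt_or_ge l s with h | h
      · obtain rfl : s = l + 1 := by omega
        simp
      · rw [ih s h]
    rw [mergeOp, mergeOp, h _ _ (by omega), ih _ (by omega), h1]

lemma stageOp_congr (f g : ℕ → ℕ → ℤ) (h : ∀ k s, s ≤ k → f k s = g k s) (l s : ℕ) (hs : s ≤ l) :
    stageOp f l s = stageOp g l s := by
  rw [stageOp, stageOp, h _ _ (by omega), h _ _ (by omega), mergeOp_congr f g h l s hs]

lemma stagesOp_adjoinOp (N q : ℕ) (f : ℕ → ℕ → ℤ) (l s : ℕ) (hs : s ≤ l) :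
    adjoinOp N (stagesOp f q) l s = stagesOp (adjoinOp (N + q) f) q l s := by
  induction q generalizing N l s with
  | zero => rfl
  | succ q ih =>
    rw [stagesOp, stagesOp, adjoinOp_stageOp _ _ _ _ hs]
    refine stageOp_congr _ _ (fun k s hs => ?_) _ _ hs
    rw [ih _ _ _ hs, show N + 1 + q = N + (q + 1) by ring]

lemma stagesOp_succ_zero (q : ℕ) (f : ℕ → ℕ → ℤ) :
    stagesOp f (q + 1) 0 0 = stagesOp f q 1 0 := by
  rw [stagesOp, stageOp, mergeOp]
  ring

/-- After adjoining an element, `adjoinOp` is moved outwards through all stages. There it has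
parameter 0 and is evaluated at `(0, 0)`, where only the term `f 1 0` survives; a further stage at
`(0, 0)` has the same effect. -/
theorem partitionSum_eq_stagesOp (s : Finset α) (f : ℕ → ℕ → ℤ) :
    partitionSum s f = stagesOp f s.card 0 0 := by
  induction s using Finset.induction_on generalizing f with
  | empty => exact partitionSum_empty f
  | insert a s ha ih =>
    rw [partitionSum_insert ha, ih, card_insert_of_notMem ha, stagesOp_succ_zero]
    have h := stagesOp_adjoinOp 0 s.card f 0 0 le_rfl
    rw [zero_add] at h
    rw [← h]
    simp [adjoinOp]

end PartitionSums

/-! ### Code functions of labeled partitions. -/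

section Codes

open Finset

variable {n : ℕ} {S : Type*}

/-- Codes of elements of `[[n]]` relative to a labeled partition: `inl σ` for an element of the
signed block `σ`, `inr (r, b)` for an element of an unsigned block containing `(r, b)`, where `r` is
the representative. -/
abbrev Code (n : ℕ) (S : Type*) : Type _ := S ⊕ BarSet n

/-- The action of a bar (if `b` is true) on codes. -/
def Code.twist (b : Bool) : Code n S → Code n S
  | .inl σ => .inl σ
  | .inr (r, c) => .inr (r, b ^^ c)

/-- Extend a code function from `[n]` to `[[n]]` equivariantly. -/
def codeExt (κ : Fin n → Code n S) (a : BarSet n) : Code n S := (κ a.1).twist a.2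

/-- Substitute a code function into a code. -/
def codeSubst (κ : Fin n → Code n S) : Code n S → Code n S
  | .inl σ => .inl σ
  | .inr a => codeExt κ a

/-- Every unsigned block is represented by its least element. -/
def IsCanonical (κ : Fin n → Code n S) : Prop :=
  ∀ v r b, κ v = .inr (r, b) → r ≤ v ∧ κ r = .inr (r, false)

@[simp] lemma Code.twist_inl (b : Bool) (σ : S) : Code.twist b (.inl σ : Code n S) = .inl σ := rfl

@[simp] lemma Code.twist_inr (b c : Bool) (r : Fin n) :
    Code.twist b (.inr (r, c) : Code n S) = .inr (r, b ^^ c) := rfl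

@[simp] lemma Code.twist_false (c : Code n S) : c.twist false = c := by
  rcases c with σ | ⟨r, c⟩ <;> simp

@[simp] lemma Code.twist_twist (b b' : Bool) (c : Code n S) :
    (c.twist b').twist b = c.twist (b ^^ b') := by
  rcases c with σ | ⟨r, c⟩ <;> simp

lemma Code.twist_injective (b : Bool) : Function.Injective (Code.twist b : Code n S → Code n S) := by
  intro c c' h
  have := congrArg (Code.twist b) h
  simpa using this

lemma Code.twist_eq_inl {b : Bool} {c : Code n S} {σ : S} : c.twist b = .inl σ ↔ c = .inl σ := by
  rcases c with τ | ⟨r, c⟩ <;> simp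

@[simp] lemma codeSubst_inl (κ : Fin n → Code n S) (σ : S) : codeSubst κ (.inl σ) = .inl σ := rfl

@[simp] lemma codeSubst_inr (κ : Fin n → Code n S) (r : Fin n) (b : Bool) :
    codeSubst κ (.inr (r, b)) = (κ r).twist b := rfl

lemma codeSubst_twist (κ : Fin n → Code n S) (b : Bool) (c : Code n S) :
    codeSubst κ (c.twist b) = (codeSubst κ c).twist b := by
  rcases c with σ | ⟨r, c⟩ <;> simp

lemma codeSubst_codeSubst (κ κ' : Fin n → Code n S) (c : Code n S) :
    codeSubst κ (codeSubst κ' c) = codeSubst (fun v => codeSubst κ (κ' v)) c := by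
  rcases c with σ | ⟨r, c⟩ <;> simp [codeSubst_twist]

lemma codeExt_false (κ : Fin n → Code n S) (v : Fin n) : codeExt κ (v, false) = κ v := by
  simp [codeExt]

lemma codeExt_bar (κ : Fin n → Code n S) (a : BarSet n) :
    codeExt κ (a.1, !a.2) = (codeExt κ a).twist true := by
  simp [codeExt]

lemma IsCanonical.codeSubst_self {κ : Fin n → Code n S} (h : IsCanonical κ) (v : Fin n) :
    codeSubst κ (κ v) = κ v := by
  rcases hv : κ v with σ | ⟨r, b⟩
  · rfl
  · rw [codeSubst_inr, (h v r b hv).2]; simp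

lemma IsCanonical.codeExt_of_eq {κ : Fin n → Code n S} (h : IsCanonical κ) {a b : BarSet n}
    (hab : codeExt κ a = .inr b) : codeExt κ b = .inr b := by
  obtain ⟨v, c⟩ := a
  obtain ⟨r, d⟩ := b
  rcases hv : κ v with σ | ⟨q, e⟩
  · simp [codeExt, hv] at hab
  · simp only [codeExt, hv, Code.twist_inr, Sum.inr.injEq, Prod.mk.injEq] at hab
    obtain ⟨rfl, -⟩ := hab
    simp [codeExt, (h v q e hv).2]

/-- A code function describes the blocks and signs of a labeled partition. -/
structure Encodes (κ : Fin n → Code n S) (x : SignedPartition n S) : Prop where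
  canonical : IsCanonical κ
  mem_signed : ∀ σ a, a ∈ x.signed σ ↔ codeExt κ a = .inl σ
  part_eq : ∀ a b, x.part.part a = x.part.part b ↔ codeExt κ a = codeExt κ b

lemma mem_barImage {R : Finset (BarSet n)} {a : BarSet n} :
    a ∈ barImage R ↔ (a.1, !a.2) ∈ R := by
  simp only [barImage, mem_image]
  constructor
  · rintro ⟨b, hb, rfl⟩
    simpa using hb
  · intro h
    exact ⟨_, h, by simp⟩

namespace SignedPartition

lemma part_mem' (x : SignedPartition n S) (a : BarSet n) : x.part.part a ∈ x.part.parts :=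
  x.part.part_mem.2 (mem_univ a)

lemma mem_part_self' (x : SignedPartition n S) (a : BarSet n) : a ∈ x.part.part a :=
  x.part.mem_part_self.2 (mem_univ a)

lemma part_eq_of_mem' (x : SignedPartition n S) {R : Finset (BarSet n)} (hR : R ∈ x.part.parts)
    {a : BarSet n} (ha : a ∈ R) : x.part.part a = R := x.part.part_eq_of_mem hR ha

lemma part_bar (x : SignedPartition n S) (a : BarSet n) :
    x.part.part (a.1, !a.2) = barImage (x.part.part a) :=
  x.part_eq_of_mem' (x.bar_mem _ (x.part_mem' a))
    (mem_barImage.2 (by simp [x.mem_part_self' a]))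

lemma signed_eq_part (x : SignedPartition n S) {σ : S} {a : BarSet n} (ha : a ∈ x.signed σ) :
    x.signed σ = x.part.part a :=
  (x.part_eq_of_mem' (x.signed_mem σ ⟨a, ha⟩) ha).symm

lemma bar_mem_signed (x : SignedPartition n S) {σ : S} {a : BarSet n} (ha : a ∈ x.signed σ) :
    (a.1, !a.2) ∈ x.signed σ := by
  have h := (x.bar_eq_iff _ (x.signed_mem σ ⟨a, ha⟩)).2 ⟨σ, rfl⟩
  rw [← h, mem_barImage]
  simpa using ha

lemma mem_signed_of_bar_mem (x : SignedPartition n S) {a : BarSet n}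
    (ha : (a.1, !a.2) ∈ x.part.part a) : ∃ σ, a ∈ x.signed σ := by
  have h : x.part.part (a.1, !a.2) = x.part.part a := x.part_eq_of_mem' (x.part_mem' a) ha
  rw [x.part_bar] at h
  obtain ⟨σ, hσ⟩ := (x.bar_eq_iff _ (x.part_mem' a)).1 h
  exact ⟨σ, hσ ▸ x.mem_part_self' a⟩

lemma exists_minimal_code (x : SignedPartition n S) : ∃ κ : Fin n → Code n S,
    (∀ σ a, a ∈ x.signed σ ↔ codeExt κ a = .inl σ) ∧
    ∀ a c, codeExt κ a = .inr c → (∀ σ, a ∉ x.signed σ) ∧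
      c ∈ x.part.part a ∧ ∀ b ∈ x.part.part a, c.1 ≤ b.1 := by
  have key : ∀ v : Fin n, ∃ c : Code n S,
      (∃ σ, c = .inl σ ∧ (v, false) ∈ x.signed σ) ∨
      ∃ a, c = .inr a ∧ (∀ σ, (v, false) ∉ x.signed σ) ∧ a ∈ x.part.part (v, false) ∧
        ∀ b ∈ x.part.part (v, false), a.1 ≤ b.1 := by
    intro v
    by_cases h : ∃ σ, (v, false) ∈ x.signed σ
    · obtain ⟨σ, h⟩ := h
      exact ⟨_, Or.inl ⟨σ, rfl, h⟩⟩
    · push Not at h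
      obtain ⟨a, ha, hmin⟩ := exists_min_image (x.part.part (v, false)) Prod.fst
        ⟨_, x.mem_part_self' _⟩
      exact ⟨_, Or.inr ⟨a, rfl, h, ha, hmin⟩⟩
  choose κ hκ using key
  have hinl : ∀ v σ, κ v = .inl σ ↔ (v, false) ∈ x.signed σ := by
    intro v σ
    rcases hκ v with ⟨τ, h1, h2⟩ | ⟨a, h1, h2, -⟩
    · rw [h1, Sum.inl.injEq]
      constructor
      · rintro rfl; exact h2
      · intro h
        exact x.signed_inj _ _ ⟨_, h2⟩ ((x.signed_eq_part h2).trans (x.signed_eq_part h).symm)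
    · simp [h1, h2 σ]
  have hinr : ∀ v a, κ v = .inr a → (∀ σ, (v, false) ∉ x.signed σ) ∧
      a ∈ x.part.part (v, false) ∧ ∀ b ∈ x.part.part (v, false), a.1 ≤ b.1 := by
    intro v a h
    rcases hκ v with ⟨τ, h1, h2⟩ | ⟨a', h1, h2⟩
    · simp [h1] at h
    · rw [h1, Sum.inr.injEq] at h
      exact h ▸ h2
  have hsig : ∀ σ a, a ∈ x.signed σ ↔ codeExt κ a = .inl σ := by
    rintro σ ⟨v, b⟩
    rw [codeExt, Code.twist_eq_inl, hinl]
    cases b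
    · rfl
    · exact ⟨fun h => x.bar_mem_signed h, fun h => x.bar_mem_signed h⟩
  have hext : ∀ a c, codeExt κ a = .inr c → (∀ σ, a ∉ x.signed σ) ∧
      c ∈ x.part.part a ∧ ∀ b ∈ x.part.part a, c.1 ≤ b.1 := by
    rintro ⟨v, b⟩ c hc
    refine ⟨fun σ h => by simp [(hsig _ _).1 h] at hc, ?_⟩
    cases b
    · rw [codeExt_false] at hc
      exact (hinr v c hc).2
    · rcases hv : κ v with σ | ⟨r, e⟩
      · simp [codeExt, hv] at hc
      · obtain ⟨-, h2, h3⟩ := hinr v _ hv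
        simp only [codeExt, hv, Code.twist_inr, Bool.true_bne, Sum.inr.injEq] at hc
        subst hc
        have hb := x.part_bar (v, false)
        simp only [Bool.not_false] at hb
        rw [hb]
        refine ⟨mem_barImage.2 (by simpa using h2), fun b hb => ?_⟩
        exact h3 (b.1, !b.2) (mem_barImage.1 hb)
  exact ⟨κ, hsig, hext⟩

/-- The code names an element of least index in each unsigned block. It is unambiguous: a block that
contains both `r` and its barred copy meets its own bar image, hence equals it and is signed. -/
lemma exists_code (x : SignedPartition n S) : ∃ κ, Encodes κ x := by
  obtain ⟨κ, hsig, hext⟩ := x.exists_minimal_code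
  have hpart : ∀ {a b : BarSet n}, a ∈ x.part.part b → x.part.part a = x.part.part b :=
    fun h => x.part_eq_of_mem' (x.part_mem' _) h
  -- An unsigned block contains at most one of `r` and its barred copy.
  have hbar : ∀ {a c d : BarSet n}, (∀ σ, a ∉ x.signed σ) → c ∈ x.part.part a →
      d ∈ x.part.part a → c.1 = d.1 → c = d := by
    rintro a ⟨r, c⟩ ⟨q, d⟩ hns hc hd (rfl : r = q)
    by_contra hne
    have hcd : d = !c := by
      rw [← Bool.not_eq_eq_eq_not, Bool.not_eq]
      rintro rfl
      exact hne rfl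
    subst hcd
    obtain ⟨σ, hσ⟩ := x.mem_signed_of_bar_mem (a := (r, c)) (by rw [hpart hc]; exact hd)
    refine hns σ ?_
    rw [x.signed_eq_part hσ, hpart hc]
    exact x.mem_part_self' a
  refine ⟨κ, ?_, hsig, ?_⟩
  · intro v r b hv
    obtain ⟨h1, h2, h3⟩ := hext (v, false) (r, b) (by rw [codeExt_false, hv])
    refine ⟨h3 _ (x.mem_part_self' _), ?_⟩
    rcases hr : κ r with σ | ⟨q, e⟩
    · have hs : (r, b) ∈ x.signed σ := (hsig _ _).2 (by simp [codeExt, hr])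
      have : (v, false) ∈ x.signed σ := by
        rw [x.signed_eq_part hs, hpart h2]
        exact x.mem_part_self' _
      exact absurd this (h1 σ)
    · obtain ⟨-, h5, h6⟩ := hext (r, b) (q, b ^^ e) (by simp [codeExt, hr])
      rw [hpart h2] at h5 h6
      have hqr : q = r := le_antisymm (h6 _ h2) (h3 _ h5)
      subst hqr
      have := hbar h1 h5 h2 rfl
      simp only [Prod.mk.injEq, true_and] at this
      cases e
      · rfl
      · simp at this
  · intro a b
    constructor
    · intro h
      rcases ha : codeExt κ a with σ | c
      · have hs := (hsig σ a).2 ha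
        refine ((hsig σ b).1 ?_).symm
        rw [x.signed_eq_part hs, h]
        exact x.mem_part_self' _
      · rcases hb : codeExt κ b with σ | d
        · have hs := (hsig σ b).2 hb
          have : a ∈ x.signed σ := by
            rw [x.signed_eq_part hs, ← h]
            exact x.mem_part_self' _
          rw [(hsig σ a).1 this] at ha
          exact ha.symm
        · obtain ⟨h1, h2, h3⟩ := hext _ _ ha
          obtain ⟨-, h5, h6⟩ := hext _ _ hb
          rw [← h] at h5 h6
          rw [hbar h1 h2 h5 (le_antisymm (h3 _ h5) (h6 _ h2))]
    · intro h
      rcases ha : codeExt κ a with σ | c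
      · have hs := (hsig σ a).2 ha
        have ht := (hsig σ b).2 (h ▸ ha)
        rw [← x.signed_eq_part hs, ← x.signed_eq_part ht]
      · rw [← hpart (hext _ _ ha).2.1, hpart (hext _ _ (h ▸ ha)).2.1]

end SignedPartition

lemma codeExt_bar_eq_iff (κ : Fin n → Code n S) (a : BarSet n) :
    codeExt κ (a.1, !a.2) = codeExt κ a ↔ ∃ σ, codeExt κ a = .inl σ := by
  rw [codeExt_bar]
  rcases codeExt κ a with σ | ⟨r, c⟩ <;> simp

open Classical in
/-- The labeled partition with a given code function. -/
noncomputable def ofCode (κ : Fin n → Code n S) : SignedPartition n S where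
  part := Finpartition.ofSetoid (Setoid.ker (codeExt κ))
  signed σ := univ.filter fun a => codeExt κ a = .inl σ
  signed_mem := by
    rintro σ ⟨a, ha⟩
    simp only [Finpartition.ofSetoid, Finpartition.ofSetSetoid, mem_image]
    refine ⟨a, mem_univ _, ?_⟩
    ext b
    simp only [mem_filter, mem_univ, true_and] at ha ⊢
    rw [← ha]
    exact eq_comm
  signed_inj := by
    rintro σ τ ⟨a, ha⟩ h
    have h' := h ▸ ha
    simp only [mem_filter, mem_univ, true_and] at ha h'
    rw [ha] at h'
    exact Sum.inl_injective h'
  bar_mem := by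
    intro R hR
    simp only [Finpartition.ofSetoid, Finpartition.ofSetSetoid, mem_image] at hR ⊢
    obtain ⟨a, -, rfl⟩ := hR
    refine ⟨(a.1, !a.2), mem_univ _, ?_⟩
    ext b
    rw [mem_barImage]
    simp only [mem_filter, mem_univ, true_and]
    change codeExt κ _ = codeExt κ _ ↔ codeExt κ _ = codeExt κ _
    rw [codeExt_bar, codeExt_bar]
    constructor
    · intro h; rw [← h]; simp
    · intro h; rw [h]; simp
  bar_eq_iff := by
    intro R hR
    simp only [Finpartition.ofSetoid, Finpartition.ofSetSetoid, mem_image] at hR ⊢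
    obtain ⟨a, -, rfl⟩ := hR
    constructor
    · intro h
      have ha : a ∈ barImage (univ.filter fun b => (Setoid.ker (codeExt κ)) a b) := by
        rw [h]; simp
      rw [mem_barImage] at ha
      simp only [mem_filter, mem_univ, true_and] at ha
      obtain ⟨σ, hσ⟩ := (codeExt_bar_eq_iff κ a).1 (Eq.symm ha)
      refine ⟨σ, ?_⟩
      ext b
      simp only [mem_filter, mem_univ, true_and]
      rw [← hσ]
      exact eq_comm
    · rintro ⟨σ, hσ⟩
      rw [← hσ]
      ext b
      simp only [mem_barImage, mem_filter, mem_univ, true_and, codeExt_bar, Code.twist_eq_inl]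

lemma ofCode_encodes {κ : Fin n → Code n S} (h : IsCanonical κ) : Encodes κ (ofCode κ) := by
  classical
  refine ⟨h, fun σ a => by simp [ofCode], fun a b => ?_⟩
  rw [← Finpartition.mem_part_iff_part_eq_part _ (mem_univ a) (mem_univ b)]
  change a ∈ (Finpartition.ofSetoid (Setoid.ker (codeExt κ))).part b ↔ _
  rw [Finpartition.mem_part_ofSetoid_iff_rel]
  exact eq_comm

lemma codeSubst_codeExt {κ κ' : Fin n → Code n S} (h : ∀ v, codeSubst κ' (κ v) = κ' v)
    (a : BarSet n) : codeSubst κ' (codeExt κ a) = codeExt κ' a := by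
  rw [codeExt, codeSubst_twist, h, codeExt]

/-- It suffices to compare every element with the representative, or the sign, that `κ` assigns to
it: `x` refines `y` when `κ'` does not separate the two. -/
lemma Encodes.le_iff {κ κ' : Fin n → Code n S} {x y : SignedPartition n S} (hx : Encodes κ x)
    (hy : Encodes κ' y) : x ≤ y ↔ ∀ v, codeSubst κ' (κ v) = κ' v := by
  constructor
  · rintro ⟨hp, hs⟩ v
    rcases hv : κ v with σ | ⟨r, b⟩
    · have h1 : (v, false) ∈ x.signed σ := (hx.mem_signed _ _).2 (by rw [codeExt_false, hv])
      have h2 := (hy.mem_signed _ _).1 (hs σ h1)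
      rw [codeExt_false] at h2
      rw [h2]; rfl
    · have h1 : x.part.part (r, b) = x.part.part (v, false) := by
        rw [hx.part_eq, codeExt_false, hv]
        exact hx.canonical.codeExt_of_eq (a := (v, false)) (by rw [codeExt_false, hv])
      obtain ⟨R, hR, hle⟩ := hp (x.part_mem' (v, false))
      have h2 : y.part.part (r, b) = y.part.part (v, false) := by
        rw [y.part_eq_of_mem' hR (hle (x.mem_part_self' _)),
          y.part_eq_of_mem' hR (hle (h1 ▸ x.mem_part_self' (r, b)))]
      rw [hy.part_eq, codeExt_false] at h2
      exact h2
  · intro h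
    have h' := codeSubst_codeExt h
    refine ⟨?_, fun σ a ha => ?_⟩
    · intro R hR
      obtain ⟨a, ha⟩ := x.part.nonempty_of_mem_parts hR
      refine ⟨y.part.part a, y.part_mem' a, fun b hb => ?_⟩
      have h1 : x.part.part b = x.part.part a := by
        rw [x.part_eq_of_mem' hR hb, x.part_eq_of_mem' hR ha]
      have h2 : y.part.part b = y.part.part a := by
        rw [hy.part_eq, ← h', ← h', (hx.part_eq _ _).1 h1]
      exact h2 ▸ y.mem_part_self' b
    · rw [hy.mem_signed, ← h', (hx.mem_signed _ _).1 ha]; rfl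

/-- Representatives are least elements, so under mutual refinement a representative for `κ` must
also be one for `κ'`; substitution then changes nothing. -/
lemma IsCanonical.eq_of_subst {κ κ' : Fin n → Code n S} (h : IsCanonical κ) (h' : IsCanonical κ')
    (h1 : ∀ v, codeSubst κ' (κ v) = κ' v) (h2 : ∀ v, codeSubst κ (κ' v) = κ v) : κ = κ' := by
  have root : ∀ v, κ v = .inr (v, false) → κ' v = .inr (v, false) := by
    intro v hv
    have h3 := h2 v
    rcases hv' : κ' v with σ | ⟨r, b⟩
    · simp [hv', hv] at h3
    · rw [hv', codeSubst_inr, hv] at h3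
      rcases hr : κ r with σ | ⟨q, e⟩
      · simp [hr] at h3
      · simp only [hr, Code.twist_inr, Sum.inr.injEq, Prod.mk.injEq] at h3
        have hq : q = r := by
          rw [h3.1]
          exact le_antisymm (h3.1 ▸ (h r q e hr).1) (h' v r b hv').1
        subst hq
        have := (h q q e hr).2
        rw [hr] at this
        simp only [Sum.inr.injEq, Prod.mk.injEq, true_and] at this
        simp_all
  funext v
  rw [← h1 v]
  rcases hv : κ v with σ | ⟨r, b⟩
  · rfl
  · rw [codeSubst_inr, root r (h v r b hv).2]; simp

lemma Encodes.eq {κ : Fin n → Code n S} {x y : SignedPartition n S} (hx : Encodes κ x)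
    (hy : Encodes κ y) : x = y :=
  le_antisymm ((hx.le_iff hy).2 hx.canonical.codeSubst_self)
    ((hy.le_iff hx).2 hx.canonical.codeSubst_self)

lemma Encodes.code_eq {κ κ' : Fin n → Code n S} {x : SignedPartition n S} (h : Encodes κ x)
    (h' : Encodes κ' x) : κ = κ' :=
  h.canonical.eq_of_subst h'.canonical ((h.le_iff h').1 le_rfl) ((h'.le_iff h).1 le_rfl)

end Codes

/-! ### Elementary moves and factorization of refinements. -/

section Moves

open Finset

variable {n : ℕ} {S : Type*}

open Classical in
/-- The representatives of the unsigned blocks. -/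
noncomputable def codeRoots (κ : Fin n → Code n S) : Finset (Fin n) :=
  {v | κ v = .inr (v, false)}

open Classical in
/-- The representatives of the unsigned blocks with more than one element. -/
noncomputable def codeNonsingletons (κ : Fin n → Code n S) : Finset (Fin n) :=
  {r ∈ codeRoots κ | ∃ v ≠ r, ∃ b, κ v = .inr (r, b)}

open Classical in
/-- The signs of the signed blocks. -/
noncomputable def codeSigns [Fintype S] (κ : Fin n → Code n S) : Finset S :=
  {σ | ∃ v, κ v = .inl σ}

/-- Refinement in terms of code functions. -/
def CodeLE (κ κ' : Fin n → Code n S) : Prop := ∀ v, codeSubst κ' (κ v) = κ' v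

/-- The code function that results from merging the block with representative `i` into the signed
block or the unsigned block that `c` describes. -/
def moveCode (κ : Fin n → Code n S) (i : Fin n) (c : Code n S) (v : Fin n) : Code n S :=
  codeSubst (Function.update (fun u => .inr (u, false)) i c) (κ v)

/-- No signed block with a sign outside `F` has only two elements. -/
def IsAdmissible (F : Set S) (κ : Fin n → Code n S) : Prop :=
  ∀ σ, σ ∉ F → ∀ v, κ v = .inl σ → ∃ u, u ≠ v ∧ κ u = .inl σ

/-- The block with representative `i` can be merged into the signed block `σ`. -/
def CanSign [Fintype S] (F : Set S) (κ : Fin n → Code n S) (σ : S) (i : Fin n) : Prop :=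
  σ ∈ F ∨ σ ∈ codeSigns κ ∨ i ∈ codeNonsingletons κ

/-- The merge that `moveCode κ i c` describes is possible. -/
def IsMove [Fintype S] (F : Set S) (κ : Fin n → Code n S) (i : Fin n) (c : Code n S) : Prop :=
  i ∈ codeRoots κ ∧ (∀ r b, c = .inr (r, b) → r < i ∧ r ∈ codeRoots κ) ∧
    ∀ σ, c = .inl σ → CanSign F κ σ i

variable {κ κ' : Fin n → Code n S} {i : Fin n} {c : Code n S} {F : Set S}

lemma mem_codeRoots {v : Fin n} : v ∈ codeRoots κ ↔ κ v = .inr (v, false) := by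
  simp [codeRoots]

lemma mem_codeNonsingletons {r : Fin n} : r ∈ codeNonsingletons κ ↔
    r ∈ codeRoots κ ∧ ∃ v, v ≠ r ∧ ∃ b, κ v = .inr (r, b) := by
  simp [codeNonsingletons]

lemma mem_codeSigns [Fintype S] {σ : S} : σ ∈ codeSigns κ ↔ ∃ v, κ v = .inl σ := by
  simp [codeSigns]

lemma IsCanonical.mem_codeRoots (h : IsCanonical κ) {v r : Fin n} {b : Bool}
    (hv : κ v = .inr (r, b)) : r ∈ codeRoots κ :=
  _root_.mem_codeRoots.2 (h v r b hv).2

lemma moveCode_of_inl {v : Fin n} {σ : S} (h : κ v = .inl σ) : moveCode κ i c v = .inl σ := by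
  rw [moveCode, h]; rfl

lemma moveCode_of_inr_self {v : Fin n} {b : Bool} (h : κ v = .inr (i, b)) :
    moveCode κ i c v = c.twist b := by
  rw [moveCode, h]; simp

lemma moveCode_of_inr_ne {v r : Fin n} {b : Bool} (h : κ v = .inr (r, b)) (hr : r ≠ i) :
    moveCode κ i c v = .inr (r, b) := by
  rw [moveCode, h]; simp [hr]

lemma moveCode_of_root {u : Fin n} (h : u ∈ codeRoots κ) (hu : u ≠ i) :
    moveCode κ i c u = .inr (u, false) := moveCode_of_inr_ne (mem_codeRoots.1 h) hu

lemma moveCode_self (h : i ∈ codeRoots κ) : moveCode κ i c i = c := by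
  rw [moveCode_of_inr_self (mem_codeRoots.1 h)]; simp

lemma moveCode_eq_inl_iff {v : Fin n} {τ : S} : moveCode κ i c v = .inl τ ↔
    κ v = .inl τ ∨ (c = .inl τ ∧ ∃ b, κ v = .inr (i, b)) := by
  rcases hv : κ v with σ | ⟨r, b⟩
  · rw [moveCode_of_inl hv]; simp
  · by_cases hr : r = i
    · subst hr
      rw [moveCode_of_inr_self hv, Code.twist_eq_inl]; simp
    · rw [moveCode_of_inr_ne hv hr]; simp [hr]

lemma moveCode_eq_inr_iff {v r : Fin n} {b : Bool} : moveCode κ i c v = .inr (r, b) ↔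
    (κ v = .inr (r, b) ∧ r ≠ i) ∨ ∃ d, κ v = .inr (i, d) ∧ c = .inr (r, d ^^ b) := by
  rcases hv : κ v with σ | ⟨q, e⟩
  · rw [moveCode_of_inl hv]; simp
  · by_cases hq : q = i
    · subst hq
      rw [moveCode_of_inr_self hv]
      have : c.twist e = .inr (r, b) ↔ c = .inr (r, e ^^ b) := by
        rw [← (Code.twist_injective e).eq_iff, Code.twist_twist]; simp
      rw [this]
      constructor
      · intro h; exact Or.inr ⟨e, rfl, h⟩
      · rintro (⟨h, h'⟩ | ⟨d, h, h'⟩)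
        · simp only [Sum.inr.injEq, Prod.mk.injEq] at h
          exact absurd h.1.symm h'
        · simp only [Sum.inr.injEq, Prod.mk.injEq, true_and] at h
          rw [h, h']
    · rw [moveCode_of_inr_ne hv hq]
      constructor
      · intro h
        refine Or.inl ⟨h, ?_⟩
        simp only [Sum.inr.injEq, Prod.mk.injEq] at h
        rw [← h.1]; exact hq
      · rintro (⟨h, h'⟩ | ⟨d, h, h'⟩)
        · exact h
        · simp only [Sum.inr.injEq, Prod.mk.injEq] at h
          exact absurd h.1 hq

lemma IsCanonical.isCanonical_moveCode (h : IsCanonical κ)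
    (hc : ∀ r b, c = .inr (r, b) → r < i ∧ r ∈ codeRoots κ) : IsCanonical (moveCode κ i c) := by
  intro v r b hv
  rcases moveCode_eq_inr_iff.1 hv with ⟨h1, h2⟩ | ⟨d, h1, h2⟩
  · exact ⟨(h v r b h1).1, moveCode_of_root (h.mem_codeRoots h1) h2⟩
  · obtain ⟨h3, h4⟩ := hc _ _ h2
    exact ⟨h3.le.trans (h v i d h1).1, moveCode_of_root h4 h3.ne⟩

lemma codeRoots_moveCode (hc : ∀ r b, c = .inr (r, b) → r < i ∧ r ∈ codeRoots κ) :
    codeRoots (moveCode κ i c) = (codeRoots κ).erase i := by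
  ext v
  rw [mem_erase, mem_codeRoots, mem_codeRoots, moveCode_eq_inr_iff]
  constructor
  · rintro (⟨h1, h2⟩ | ⟨d, h1, h2⟩)
    · exact ⟨h2, h1⟩
    · obtain ⟨h3, h4⟩ := hc _ _ h2
      rw [mem_codeRoots.1 h4] at h1
      simp only [Sum.inr.injEq, Prod.mk.injEq] at h1
      exact absurd h1.1 h3.ne
  · rintro ⟨h1, h2⟩
    exact Or.inl ⟨h2, h1⟩

lemma card_codeRoots_moveCode (hi : i ∈ codeRoots κ)
    (hc : ∀ r b, c = .inr (r, b) → r < i ∧ r ∈ codeRoots κ) :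
    (codeRoots (moveCode κ i c)).card + 1 = (codeRoots κ).card := by
  rw [codeRoots_moveCode hc, card_erase_add_one hi]

lemma IsCanonical.codeLE_moveCode (h : IsCanonical κ) : CodeLE κ (moveCode κ i c) := by
  intro v
  rcases hv : κ v with σ | ⟨r, b⟩
  · rw [moveCode_of_inl hv]; rfl
  · rw [codeSubst_inr]
    have hr := (h v r b hv).2
    by_cases hri : r = i
    · subst hri
      rw [moveCode_of_inr_self hr, moveCode_of_inr_self hv]; simp
    · rw [moveCode_of_inr_ne hr hri, moveCode_of_inr_ne hv hri]; simp

lemma CodeLE.moveCode_le (h : CodeLE κ κ') (hc : codeSubst κ' c = κ' i) :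
    CodeLE (moveCode κ i c) κ' := by
  intro v
  rw [moveCode, codeSubst_codeSubst]
  have : (fun u => codeSubst κ' (Function.update (fun u => (.inr (u, false) : Code n S)) i c u)) = κ' := by
    funext u
    by_cases hu : u = i
    · subst hu; simpa using hc
    · simp [hu]
  rw [this, h v]

lemma codeNonsingletons_merge {r : Fin n} {b : Bool} (hi : i ∈ codeRoots κ)
    (hr : r < i) (hr' : r ∈ codeRoots κ) :
    codeNonsingletons (moveCode κ i (.inr (r, b))) = insert r ((codeNonsingletons κ).erase i) := by
  have hc : ∀ r' b', (.inr (r, b) : Code n S) = .inr (r', b') → r' < i ∧ r' ∈ codeRoots κ := by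
    rintro r' b' h
    simp only [Sum.inr.injEq, Prod.mk.injEq] at h
    obtain ⟨rfl, -⟩ := h
    exact ⟨hr, hr'⟩
  ext q
  rw [mem_codeNonsingletons, codeRoots_moveCode hc, mem_insert, mem_erase, mem_erase,
    mem_codeNonsingletons]
  constructor
  · rintro ⟨⟨h1, h2⟩, v, hv, d, hd⟩
    rcases moveCode_eq_inr_iff.1 hd with ⟨h3, -⟩ | ⟨e, h3, h4⟩
    · exact Or.inr ⟨h1, h2, v, hv, d, h3⟩
    · simp only [Sum.inr.injEq, Prod.mk.injEq] at h4
      exact Or.inl h4.1.symm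
  · rintro (rfl | ⟨h1, h2, v, hv, d, hd⟩)
    · exact ⟨⟨hr.ne, hr'⟩, i, hr.ne', b, moveCode_self hi⟩
    · exact ⟨⟨h1, h2⟩, v, hv, d, moveCode_of_inr_ne hd h1⟩

lemma codeNonsingletons_sign {σ : S} :
    codeNonsingletons (moveCode κ i (.inl σ)) = (codeNonsingletons κ).erase i := by
  ext q
  rw [mem_codeNonsingletons, codeRoots_moveCode (by simp), mem_erase, mem_erase,
    mem_codeNonsingletons]
  simp only [moveCode_eq_inr_iff]
  constructor
  · rintro ⟨⟨h1, h2⟩, v, hv, d, h3 | ⟨e, h3, h4⟩⟩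
    · exact ⟨h1, h2, v, hv, d, h3.1⟩
    · simp at h4
  · rintro ⟨h1, h2, v, hv, d, hd⟩
    exact ⟨⟨h1, h2⟩, v, hv, d, Or.inl ⟨hd, h1⟩⟩

lemma codeSigns_merge [Fintype S] {a : BarSet n} :
    codeSigns (moveCode κ i (.inr a)) = codeSigns κ := by
  ext σ
  simp [mem_codeSigns, moveCode_eq_inl_iff]

lemma codeSigns_sign [Fintype S] [DecidableEq S] {σ : S} (hi : i ∈ codeRoots κ) :
    codeSigns (moveCode κ i (.inl σ)) = insert σ (codeSigns κ) := by
  ext τ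
  simp only [mem_codeSigns, moveCode_eq_inl_iff, mem_insert, Sum.inl.injEq]
  constructor
  · rintro ⟨v, h | ⟨h, -⟩⟩
    · exact Or.inr ⟨v, h⟩
    · exact Or.inl h.symm
  · rintro (rfl | ⟨v, h⟩)
    · exact ⟨i, Or.inr ⟨rfl, false, mem_codeRoots.1 hi⟩⟩
    · exact ⟨v, Or.inl h⟩

lemma IsAdmissible.isAdmissible_moveCode [Fintype S] (h : IsAdmissible F κ) (hc : IsMove F κ i c) :
    IsAdmissible F (moveCode κ i c) := by
  intro σ hσ v hv
  have hcases : κ v = .inl σ → ∃ u, u ≠ v ∧ moveCode κ i c u = .inl σ := fun h1 => by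
    obtain ⟨u, hu, hu'⟩ := h σ hσ v h1
    exact ⟨u, hu, moveCode_of_inl hu'⟩
  rcases moveCode_eq_inl_iff.1 hv with h1 | ⟨rfl, b, h1⟩
  · exact hcases h1
  · rcases hc.2.2 σ rfl with h2 | h2 | h2
    · exact absurd h2 hσ
    · obtain ⟨u, hu⟩ := mem_codeSigns.1 h2
      refine ⟨u, ?_, moveCode_of_inl hu⟩
      rintro rfl
      simp [hu] at h1
    · obtain ⟨-, u, hu, d, hd⟩ := mem_codeNonsingletons.1 h2
      by_cases huv : v = i
      · exact ⟨u, huv ▸ hu, moveCode_eq_inl_iff.2 (Or.inr ⟨rfl, d, hd⟩)⟩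
      · exact ⟨i, fun h => huv h.symm,
          moveCode_eq_inl_iff.2 (Or.inr ⟨rfl, false, mem_codeRoots.1 hc.1⟩)⟩

/-- A strict refinement factors through a move. -/
lemma CodeLE.exists_isMove [Fintype S] (h : CodeLE κ κ') (hκ : IsCanonical κ) (hκ' : IsCanonical κ')
    (ha : IsAdmissible F κ') (hne : κ ≠ κ') :
    ∃ i c, IsMove F κ i c ∧ codeSubst κ' c = κ' i := by
  obtain ⟨v, hv, hv'⟩ : ∃ v ∈ codeRoots κ, κ' v ≠ .inr (v, false) := by
    by_contra! hcon
    apply hne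
    funext v
    rw [← h v]
    rcases hv : κ v with σ | ⟨r, b⟩
    · rfl
    · rw [codeSubst_inr, hcon r (hκ.mem_codeRoots hv)]; simp
  rcases hv1 : κ' v with σ | ⟨r, b⟩
  · by_cases hs : CanSign F κ σ v
    · exact ⟨v, .inl σ, ⟨hv, by simp, by rintro τ ⟨rfl⟩; exact hs⟩, hv1.symm ▸ rfl⟩
    · simp only [CanSign, not_or] at hs
      obtain ⟨hσ, hs1, hs2⟩ := hs
      -- Here the block of `v` is a singleton that may not start the block `σ` alone. Admissibility
      -- of `κ'` gives a second element `u` of that block, so the blocks of `v` and `u` can be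
      -- merged first; the smaller representative survives.
      obtain ⟨u, huv, hu⟩ := ha σ hσ v hv1
      rcases hu1 : κ u with τ | ⟨q, d⟩
      · have := h u
        rw [hu1, hu] at this
        simp only [codeSubst_inl, Sum.inl.injEq] at this
        subst this
        exact absurd (mem_codeSigns.2 ⟨u, hu1⟩) hs1
      · have hq := hκ.mem_codeRoots hu1
        have hq' : κ' q = .inl σ := by
          have := h u
          rwa [hu1, hu, codeSubst_inr, Code.twist_eq_inl] at this
        have hqv : q ≠ v := by
          rintro rfl
          exact hs2 (mem_codeNonsingletons.2 ⟨hv, u, huv, d, hu1⟩)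
        rcases lt_or_gt_of_ne hqv with hlt | hlt
        · refine ⟨v, .inr (q, false), ⟨hv, ?_, by simp⟩, by simp [hq', hv1]⟩
          rintro r b ⟨⟩
          exact ⟨hlt, hq⟩
        · refine ⟨q, .inr (v, false), ⟨hq, ?_, by simp⟩, by simp [hq', hv1]⟩
          rintro r b ⟨⟩
          exact ⟨hlt, hv⟩
  · obtain ⟨hrv, hr⟩ := hκ' v r b hv1
    have hrne : r ≠ v := by
      rintro rfl
      exact hv' hr
    -- The block of `κ` containing `r` lies in the block of `κ'` with least index `r`, so its
    -- representative is `r` itself.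
    have hrκ : r ∈ codeRoots κ := by
      have h1 := h r
      rcases hr1 : κ r with τ | ⟨q, d⟩
      · rw [hr1, hr] at h1; simp at h1
      · rw [hr1, hr, codeSubst_inr] at h1
        have h2 : κ' q = .inr (r, d) := by
          apply Code.twist_injective d
          rw [h1]; simp
        have hqr : q = r := le_antisymm (hκ r q d hr1).1 (hκ' q r d h2).1
        subst hqr
        exact hκ.mem_codeRoots hr1
    refine ⟨v, .inr (r, b), ⟨hv, ?_, by simp⟩, by simp [hr, hv1]⟩
    rintro r' b' ⟨⟩
    exact ⟨lt_of_le_of_ne hrv hrne, hrκ⟩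

/-- The number of representatives serves as a corank: `κ'` is reached from `κ` by a nonempty
sequence of moves, each removing one. -/
lemma CodeLE.card_codeRoots_lt [Fintype S] (h : CodeLE κ κ') (hκ : IsCanonical κ)
    (hκ' : IsCanonical κ') (ha : IsAdmissible F κ') (hne : κ ≠ κ') :
    (codeRoots κ').card < (codeRoots κ).card := by
  induction hk : (codeRoots κ).card generalizing κ with
  | zero =>
    obtain ⟨i, c, hm, -⟩ := h.exists_isMove hκ hκ' ha hne
    rw [card_eq_zero] at hk
    exact absurd hm.1 (by simp [hk])
  | succ k ih =>
    obtain ⟨i, c, hm, hc⟩ := h.exists_isMove hκ hκ' ha hne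
    have hcard := card_codeRoots_moveCode hm.1 hm.2.1
    by_cases heq : moveCode κ i c = κ'
    · rw [← heq]; omega
    · have := ih (h.moveCode_le hc) (hκ.isCanonical_moveCode hm.2.1) heq (by omega)
      omega

end Moves

/-! ### Edge labels in terms of codes. -/

section Labels

open Finset

variable {n : ℕ} {S : Type*} {κ κ' : Fin n → Code n S} {x y : SignedPartition n S}

lemma codeExt_eq_inr_iff {a : BarSet n} {r : Fin n} {b : Bool} :
    codeExt κ a = .inr (r, b) ↔ κ a.1 = .inr (r, a.2 ^^ b) := by
  rw [codeExt, ← (Code.twist_injective a.2).eq_iff]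
  simp

lemma Encodes.mem_part (h : Encodes κ x) {a b : BarSet n} :
    a ∈ x.part.part b ↔ codeExt κ a = codeExt κ b := by
  rw [← h.part_eq, Finpartition.mem_part_iff_part_eq_part _ (mem_univ a) (mem_univ b)]

lemma Encodes.mem_part_root (h : Encodes κ x) {r : Fin n} (hr : r ∈ codeRoots κ) {a : BarSet n} :
    a ∈ x.part.part (r, false) ↔ codeExt κ a = .inr (r, false) := by
  rw [h.mem_part, codeExt_false, mem_codeRoots.1 hr]

lemma Encodes.representative_root (h : Encodes κ x) {r : Fin n} (hr : r ∈ codeRoots κ) :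
    representative (x.part.part (r, false)) = r + 1 := by
  apply IsLeast.csInf_eq
  refine ⟨⟨(r, false), x.mem_part_self' _, rfl⟩, ?_⟩
  rintro _ ⟨a, ha, rfl⟩
  rw [h.mem_part_root hr, codeExt_eq_inr_iff] at ha
  have := (h.canonical _ _ _ ha).1
  simpa using this

lemma Encodes.isUnsignedBlock_root (h : Encodes κ x) {r : Fin n} (hr : r ∈ codeRoots κ) :
    x.IsUnsignedBlock (x.part.part (r, false)) := by
  refine ⟨x.part_mem' _, fun σ hσ => ?_⟩
  have := (h.mem_signed σ (r, false)).1 (hσ ▸ x.mem_part_self' _)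
  rw [codeExt_false, mem_codeRoots.1 hr] at this
  simp at this

lemma Encodes.isNormalized_root (h : Encodes κ x) {r : Fin n} (hr : r ∈ codeRoots κ) :
    IsNormalized (x.part.part (r, false)) :=
  ⟨r, x.mem_part_self' _, (h.representative_root hr).symm⟩

lemma Encodes.exists_root (h : Encodes κ x) {R : Finset (BarSet n)} (hR : x.IsUnsignedBlock R)
    (hn : IsNormalized R) : ∃ r ∈ codeRoots κ, R = x.part.part (r, false) := by
  obtain ⟨i, hi, hrep⟩ := hn
  have hRi := x.part_eq_of_mem' hR.1 hi
  rcases hκ : κ i with σ | ⟨r, b⟩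
  · have hs : (i, false) ∈ x.signed σ := (h.mem_signed _ _).2 (by rw [codeExt_false, hκ])
    exact absurd ((x.signed_eq_part hs).trans hRi) (hR.2 σ)
  · obtain ⟨hri, hr⟩ := h.canonical i r b hκ
    have hrR : (r, b) ∈ R := by
      rw [← hRi, h.mem_part, codeExt_false, hκ, codeExt_eq_inr_iff, hr]
      simp
    have hle : representative R ≤ r + 1 := Nat.sInf_le ⟨(r, b), hrR, rfl⟩
    have : r = i := le_antisymm hri (by rw [Fin.le_def]; omega)
    subst this
    exact ⟨r, mem_codeRoots.2 hr, hRi.symm⟩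

lemma Encodes.exists_roots (h : Encodes κ x) {p : Finset (BarSet n) × Finset (BarSet n)}
    (hp : IsNormalizedPair x p) : ∃ r ∈ codeRoots κ, ∃ q ∈ codeRoots κ, r ≠ q ∧
      p = (x.part.part (r, false), x.part.part (q, false)) := by
  obtain ⟨h1, h2, h3, h4, h5⟩ := hp
  obtain ⟨r, hr, hr'⟩ := h.exists_root h2 h3
  obtain ⟨q, hq, hq'⟩ := h.exists_root h4 h5
  refine ⟨r, hr, q, hq, ?_, Prod.ext hr' hq'⟩
  rintro rfl
  exact h1 (hr'.trans hq'.symm)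

lemma Encodes.isNormalizedPair (h : Encodes κ x) {r q : Fin n} (hr : r ∈ codeRoots κ)
    (hq : q ∈ codeRoots κ) (hrq : r ≠ q) :
    IsNormalizedPair x (x.part.part (r, false), x.part.part (q, false)) := by
  refine ⟨fun heq => ?_, h.isUnsignedBlock_root hr, h.isNormalized_root hr,
    h.isUnsignedBlock_root hq, h.isNormalized_root hq⟩
  have heq : x.part.part (r, false) = x.part.part (q, false) := heq
  rw [h.part_eq, codeExt_false, codeExt_false, mem_codeRoots.1 hr, mem_codeRoots.1 hq] at heq
  simp only [Sum.inr.injEq, Prod.mk.injEq] at heq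
  exact hrq heq.1

lemma Encodes.codeExt_eq_of_mem (h : Encodes κ x) {R : Finset (BarSet n)} (hR : R ∈ x.part.parts)
    {a b : BarSet n} (ha : a ∈ R) (hb : b ∈ R) : codeExt κ a = codeExt κ b := by
  rw [← h.part_eq, x.part_eq_of_mem' hR ha, x.part_eq_of_mem' hR hb]

section Merge

variable {i r₀ : Fin n} {b₀ : Bool}

/-- A merge identifies only one pair of representatives, with a determined bar. Hence the type of an
edge, and the label of a non-coherent one, do not depend on the pair picked by `choose` in
`edgeLabel`. -/
lemma roots_of_merge_eq_twist
    (hi : i ∈ codeRoots κ) {r q : Fin n} {b : Bool} (hr : r ∈ codeRoots κ)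
    (hq : q ∈ codeRoots κ) (hrq : r ≠ q)
    (heq : moveCode κ i (.inr (r₀, b₀)) r = (moveCode κ i (.inr (r₀, b₀)) q).twist b) :
    b = b₀ ∧ ((r = i ∧ q = r₀) ∨ (r = r₀ ∧ q = i)) := by
  by_cases h1 : r = i
  · subst h1
    rw [moveCode_self hi, moveCode_of_root hq hrq.symm] at heq
    simp only [Code.twist_inr, Sum.inr.injEq, Prod.mk.injEq] at heq
    simp [heq.1, heq.2]
  · by_cases h2 : q = i
    · subst h2
      rw [moveCode_self hi, moveCode_of_root hr hrq] at heq
      simp only [Code.twist_inr, Sum.inr.injEq, Prod.mk.injEq] at heq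
      refine ⟨?_, Or.inr ⟨heq.1, rfl⟩⟩
      have := heq.2
      revert this
      cases b <;> cases b₀ <;> simp
    · rw [moveCode_of_root hr h1, moveCode_of_root hq h2] at heq
      simp only [Code.twist_inr, Sum.inr.injEq, Prod.mk.injEq] at heq
      exact absurd heq.1 hrq

lemma Encodes.roots_of_isCoherentPair
    (hx : Encodes κ x)
    (hy : Encodes (moveCode κ i (.inr (r₀, b₀))) y)
    (hi : i ∈ codeRoots κ) {p : Finset (BarSet n) × Finset (BarSet n)}
    (hp : IsCoherentPair x y p) : b₀ = false := by
  obtain ⟨r, hr, q, hq, hrq, rfl⟩ := hx.exists_roots hp.1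
  have := hy.codeExt_eq_of_mem hp.2 (mem_union_left _ (x.mem_part_self' (r, false)))
    (mem_union_right _ (x.mem_part_self' (q, false)))
  rw [codeExt_false, codeExt_false, ← Code.twist_false (moveCode κ i _ q)] at this
  exact (roots_of_merge_eq_twist hi hr hq hrq this).1.symm

lemma Encodes.representative_of_isNonCoherentPair
    (hx : Encodes κ x)
    (hy : Encodes (moveCode κ i (.inr (r₀, b₀))) y)
    (hi : i ∈ codeRoots κ)
    (hr₀ : r₀ ∈ codeRoots κ)
    (hlt : r₀ < i) {p : Finset (BarSet n) × Finset (BarSet n)}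
    (hp : IsNonCoherentPair x y p) :
    min (representative p.1) (representative p.2) = r₀ + 1 := by
  obtain ⟨r, hr, q, hq, hrq, rfl⟩ := hx.exists_roots hp.1
  have := hy.codeExt_eq_of_mem hp.2 (mem_union_left _ (x.mem_part_self' (r, false)))
    (mem_union_right _ (show (q, true) ∈ _ from mem_barImage.2 (x.mem_part_self' (q, false))))
  rw [codeExt_false] at this
  have hlt' : (r₀ : ℕ) < i := hlt
  rcases (roots_of_merge_eq_twist hi hr hq hrq this).2 with ⟨rfl, rfl⟩ | ⟨rfl, rfl⟩ <;>
  · simp only [hx.representative_root hi, hx.representative_root hr₀]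
    omega

lemma Encodes.union_mem_parts
    (hx : Encodes κ x)
    (hy : Encodes (moveCode κ i (.inr (r₀, b₀))) y)
    (hi : i ∈ codeRoots κ)
    (hr₀ : r₀ ∈ codeRoots κ)
    (hlt : r₀ < i) :
    (x.part.part (r₀, false) ∪ if b₀ then barImage (x.part.part (i, false))
      else x.part.part (i, false)) ∈ y.part.parts := by
  convert y.part_mem' (r₀, false) using 1
  ext a
  have h1 : a ∈ (if b₀ then barImage (x.part.part (i, false)) else x.part.part (i, false)) ↔
      codeExt κ a = .inr (i, b₀) := by
    cases b₀
    · exact hx.mem_part_root hi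
    · simp only [if_true]
      rw [mem_barImage, hx.mem_part_root hi, codeExt_bar,
        ← (Code.twist_injective true).eq_iff]
      simp
  rw [mem_union, h1, hx.mem_part_root hr₀, hy.mem_part, codeExt_false,
    moveCode_of_root hr₀ hlt.ne, codeExt_eq_inr_iff, codeExt_eq_inr_iff, codeExt_eq_inr_iff,
    moveCode_eq_inr_iff]
  simp only [Sum.inr.injEq, Prod.mk.injEq, true_and, hlt.ne, ne_eq, not_false_eq_true, and_true]
  constructor
  · rintro (h | h)
    · exact Or.inl h
    · exact Or.inr ⟨_, h, by cases a.2 <;> simp⟩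
  · rintro (h | ⟨d, h, h'⟩)
    · exact Or.inl h
    · refine Or.inr (h.trans ?_)
      subst h'
      cases a.2 <;> simp

end Merge

lemma Encodes.signed_ssubset_iff {i : Fin n} {c : Code n S} (hx : Encodes κ x)
    (hy : Encodes (moveCode κ i c) y) (hi : i ∈ codeRoots κ) {τ : S} :
    x.signed τ ⊂ y.signed τ ↔ c = .inl τ := by
  have hmem : ∀ {κ : Fin n → Code n S} {x}, Encodes κ x → ∀ {a : BarSet n} {τ},
      a ∈ x.signed τ ↔ κ a.1 = .inl τ := by
    intro κ x h a τ
    rw [h.mem_signed, codeExt, Code.twist_eq_inl]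
  constructor
  · intro h
    obtain ⟨a, ha, ha'⟩ := exists_of_ssubset h
    rw [hmem hx] at ha'
    rw [hmem hy, moveCode_eq_inl_iff] at ha
    exact (ha.resolve_left ha').1
  · rintro rfl
    refine (ssubset_iff_of_subset fun a ha => ?_).2 ⟨(i, false), ?_, ?_⟩
    · rw [hmem hx] at ha
      rw [hmem hy, moveCode_of_inl ha]
    · rw [hmem hy, moveCode_self hi]
    · rw [hmem hx, mem_codeRoots.1 hi]; simp

variable [Fintype S]

lemma Encodes.signs_eq (hx : Encodes κ x) : x.signs = codeSigns κ := by
  ext σ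
  simp only [SignedPartition.signs, mem_filter, mem_univ, true_and, mem_codeSigns]
  constructor
  · rintro ⟨a, ha⟩
    refine ⟨a.1, ?_⟩
    rwa [hx.mem_signed, codeExt, Code.twist_eq_inl] at ha
  · rintro ⟨v, hv⟩
    exact ⟨(v, false), (hx.mem_signed _ _).2 (by rw [codeExt_false, hv])⟩

variable [LinearOrder S]

/-- The second component of the label of an edge of sign `σ`. -/
noncomputable def codeLabel (κ : Fin n → Code n S) (σ : S) : ℕ :=
  if σ ∈ codeSigns κ then ((codeSigns κ).filter (· ≤ σ)).card
  else ((univ.filter (· ≤ σ)) ∪ codeSigns κ).card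

lemma Encodes.signLabel_eq (hx : Encodes κ x) (σ : S) : signLabel x σ = codeLabel κ σ := by
  rw [signLabel, codeLabel, hx.signs_eq]

lemma Encodes.edgeLabel_sign {i : Fin n} {σ : S} (hx : Encodes κ x)
    (hy : Encodes (moveCode κ i (.inl σ)) y) (hi : i ∈ codeRoots κ) :
    edgeLabel (x : LabeledPartitionPoset n S) y = toLex (1, codeLabel κ σ) := by
  have h : ∃ τ, x.signed τ ⊂ y.signed τ := ⟨σ, (hx.signed_ssubset_iff hy hi).2 rfl⟩
  have hσ : h.choose = σ := by
    have := (hx.signed_ssubset_iff hy hi).1 h.choose_spec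
    exact (Sum.inl_injective this).symm
  classical
  change (if h : ∃ τ, x.signed τ ⊂ y.signed τ then _ else _) = _
  rw [dif_pos h, hσ, hx.signLabel_eq]

lemma Encodes.edgeLabel_merge {i r : Fin n} (hx : Encodes κ x)
    (hy : Encodes (moveCode κ i (.inr (r, true))) y) (hi : i ∈ codeRoots κ)
    (hr : r ∈ codeRoots κ) (hlt : r < i) :
    edgeLabel (x : LabeledPartitionPoset n S) y = toLex (2, (r : ℕ) + 1) := by
  have h1 : ¬ ∃ τ, x.signed τ ⊂ y.signed τ := fun ⟨τ, h⟩ => by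
    simpa using (hx.signed_ssubset_iff hy hi).1 h
  have h2 : ¬ ∃ p, IsCoherentPair x y p := fun ⟨p, h⟩ => by
    simpa using hx.roots_of_isCoherentPair hy hi h
  have h3 : ∃ p, IsNonCoherentPair x y p :=
    ⟨_, hx.isNormalizedPair hr hi hlt.ne, hx.union_mem_parts hy hi hr hlt⟩
  classical
  change (if h : ∃ τ, x.signed τ ⊂ y.signed τ then _ else
    if h : ∃ p, IsCoherentPair x y p then _ else
    if h : ∃ p, IsNonCoherentPair x y p then
      toLex (2, min (representative h.choose.1) (representative h.choose.2)) else _) = _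
  rw [dif_neg h1, dif_neg h2, dif_pos h3,
    hx.representative_of_isNonCoherentPair hy hi hr hlt h3.choose_spec]

/-- An upper bound suffices for coherent merges, since they are excluded from decreasing chains. -/
lemma Encodes.edgeLabel_merge_false {i r : Fin n} (hx : Encodes κ x)
    (hy : Encodes (moveCode κ i (.inr (r, false))) y) (hi : i ∈ codeRoots κ)
    (hr : r ∈ codeRoots κ) (hlt : r < i) :
    edgeLabel (x : LabeledPartitionPoset n S) y < toLex (1, 2) := by
  have h1 : ¬ ∃ τ, x.signed τ ⊂ y.signed τ := fun ⟨τ, h⟩ => by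
    simpa using (hx.signed_ssubset_iff hy hi).1 h
  have h2 : ∃ p, IsCoherentPair x y p :=
    ⟨_, hx.isNormalizedPair hr hi hlt.ne, hx.union_mem_parts hy hi hr hlt⟩
  classical
  change (if h : ∃ τ, x.signed τ ⊂ y.signed τ then _ else
    if h : ∃ p, IsCoherentPair x y p then
      toLex (0, max (representative h.choose.1) (representative h.choose.2)) else _) < _
  rw [dif_neg h1, dif_pos h2, Prod.Lex.toLex_lt_toLex]
  left
  norm_num

end Labels

/-! ### Cover relations in the subposets of types B, C and D. -/

section Subposet

open Finset

variable {n : ℕ} {S : Type*} {t : PartitionType} {σ₀ : S}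

/-- The signs whose block may have two elements. -/
def freeSigns (t : PartitionType) (σ₀ : S) : Set S :=
  match t with
  | .B => {σ₀}
  | .C => Set.univ
  | .D => ∅

lemma isOfType_iff_freeSigns {x : SignedPartition n S} :
    IsOfType t σ₀ x ↔ ∀ σ, σ ∉ freeSigns t σ₀ → (x.signed σ).card ≠ 2 := by
  cases t <;> simp [IsOfType, freeSigns]

lemma Encodes.card_signed {κ : Fin n → Code n S} {x : SignedPartition n S} (h : Encodes κ x)
    (σ : S) : (x.signed σ).card = {v | κ v = .inl σ}.ncard * 2 := by
  classical
  have : x.signed σ = (univ.filter fun v => κ v = .inl σ) ×ˢ (univ : Finset Bool) := by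
    ext a
    rw [h.mem_signed, codeExt, Code.twist_eq_inl]
    simp
  rw [this, card_product, ← Set.ncard_coe_finset]
  simp

lemma Encodes.isOfType_iff {κ : Fin n → Code n S} {x : SignedPartition n S} (h : Encodes κ x) :
    IsOfType t σ₀ x ↔ IsAdmissible (freeSigns t σ₀) κ := by
  rw [isOfType_iff_freeSigns]
  refine forall₂_congr fun σ _ => ?_
  rw [h.card_signed, show (2 : ℕ) = 1 * 2 from rfl, Ne, mul_left_inj' two_ne_zero,
    Set.ncard_eq_one]
  constructor
  · intro h1 v hv
    by_contra! h2
    refine h1 ⟨v, Set.eq_singleton_iff_unique_mem.2 ⟨hv, fun u hu => ?_⟩⟩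
    by_contra hne
    exact h2 u hne hu
  · rintro h1 ⟨v, hv⟩
    obtain ⟨h2, h3⟩ := Set.eq_singleton_iff_unique_mem.1 hv
    obtain ⟨u, hu, hu'⟩ := h1 v h2
    exact hu (h3 u hu')

open Classical in
/-- The element of the subposet with a given code function. -/
noncomputable def toSubposet (t : PartitionType) (σ₀ : S) (κ : Fin n → Code n S) :
    TypeSubposet n t σ₀ :=
  if h : IsOfType t σ₀ (ofCode κ) then
    ⟨ofCode κ, fun _ hx => WithTop.coe_injective hx ▸ h⟩ else ⊤

/-- Code functions of elements of the subposet. -/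
structure IsSubposetCode (t : PartitionType) (σ₀ : S) (κ : Fin n → Code n S) : Prop where
  canonical : IsCanonical κ
  admissible : IsAdmissible (freeSigns t σ₀) κ

variable {κ κ' : Fin n → Code n S}

lemma IsSubposetCode.encodes (h : IsSubposetCode t σ₀ κ) : Encodes κ (ofCode κ) :=
  ofCode_encodes h.canonical

lemma IsSubposetCode.toSubposet_val (h : IsSubposetCode t σ₀ κ) :
    (toSubposet t σ₀ κ).1 = ofCode κ := by
  rw [toSubposet, dif_pos (h.encodes.isOfType_iff.2 h.admissible)]

lemma IsSubposetCode.toSubposet_ne_top (h : IsSubposetCode t σ₀ κ) :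
    toSubposet t σ₀ κ ≠ ⊤ := by
  intro h'
  have := congrArg Subtype.val h'
  rw [h.toSubposet_val] at this
  exact WithTop.coe_ne_top this

lemma IsSubposetCode.toSubposet_le_iff (h : IsSubposetCode t σ₀ κ) (h' : IsSubposetCode t σ₀ κ') :
    toSubposet t σ₀ κ ≤ toSubposet t σ₀ κ' ↔ CodeLE κ κ' := by
  rw [← Subtype.coe_le_coe, h.toSubposet_val, h'.toSubposet_val, WithTop.coe_le_coe,
    h.encodes.le_iff h'.encodes]
  rfl

lemma IsSubposetCode.toSubposet_inj (h : IsSubposetCode t σ₀ κ) (h' : IsSubposetCode t σ₀ κ') :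
    toSubposet t σ₀ κ = toSubposet t σ₀ κ' ↔ κ = κ' := by
  refine ⟨fun heq => ?_, fun heq => heq ▸ rfl⟩
  have := congrArg Subtype.val heq
  rw [h.toSubposet_val, h'.toSubposet_val] at this
  exact h.encodes.code_eq (WithTop.coe_injective this ▸ h'.encodes)

lemma exists_subposetCode {X : TypeSubposet n t σ₀} (hX : X ≠ ⊤) :
    ∃ κ, IsSubposetCode t σ₀ κ ∧ X = toSubposet t σ₀ κ := by
  obtain ⟨X, hX'⟩ := X
  induction X using WithTop.recTopCoe with
  | top => exact absurd rfl hX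
  | coe x =>
    obtain ⟨κ, hκ⟩ := x.exists_code
    have h : IsSubposetCode t σ₀ κ := ⟨hκ.canonical, hκ.isOfType_iff.1 (hX' x rfl)⟩
    refine ⟨κ, h, Subtype.ext ?_⟩
    rw [h.toSubposet_val]
    exact congrArg _ (hκ.eq h.encodes)

variable [Fintype S]

lemma IsSubposetCode.moveCode (h : IsSubposetCode t σ₀ κ) {i : Fin n} {c : Code n S}
    (hm : IsMove (freeSigns t σ₀) κ i c) : IsSubposetCode t σ₀ (moveCode κ i c) :=
  ⟨h.canonical.isCanonical_moveCode hm.2.1, h.admissible.isAdmissible_moveCode hm⟩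

/-- A move lowers the number of representatives by exactly one, which leaves no room for an element
strictly in between. -/
lemma IsSubposetCode.covBy_moveCode (h : IsSubposetCode t σ₀ κ) {i : Fin n} {c : Code n S}
    (hm : IsMove (freeSigns t σ₀) κ i c) :
    toSubposet t σ₀ κ ⋖ toSubposet t σ₀ (_root_.moveCode κ i c) := by
  have hm' := h.moveCode hm
  have hcard := card_codeRoots_moveCode hm.1 hm.2.1
  constructor
  · refine lt_of_le_of_ne ((h.toSubposet_le_iff hm').2 h.canonical.codeLE_moveCode) ?_
    rw [Ne, h.toSubposet_inj hm']
    intro heq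
    rw [← heq] at hcard
    omega
  · intro Z h1 h2
    have hZ : Z ≠ ⊤ := (h2.trans_le le_top).ne
    obtain ⟨κ'', h'', rfl⟩ := exists_subposetCode hZ
    have h3 := CodeLE.card_codeRoots_lt ((h.toSubposet_le_iff h'').1 h1.le) h.canonical
      h''.canonical h''.admissible (by rw [Ne, ← h.toSubposet_inj h'']; exact h1.ne)
    have h4 := CodeLE.card_codeRoots_lt ((h''.toSubposet_le_iff hm').1 h2.le) h''.canonical
      hm'.canonical hm'.admissible (by rw [Ne, ← h''.toSubposet_inj hm']; exact h2.ne)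
    omega

/-- If no sign can be given to `i`, then its block is a singleton and there are no signs; as `n ≥
2`, another unsigned block exists and a merge is possible. Hence only elements without unsigned
blocks are covered by the top. -/
lemma IsSubposetCode.exists_isMove (h : IsSubposetCode t σ₀ κ)
    (hn : t = .B ∨ t = .D → 2 ≤ n) (hr : (codeRoots κ).Nonempty) :
    ∃ i c, IsMove (freeSigns t σ₀) κ i c := by
  obtain ⟨i, hi⟩ := hr
  by_cases hs : ∃ σ, CanSign (freeSigns t σ₀) κ σ i
  · obtain ⟨σ, hs⟩ := hs
    exact ⟨i, .inl σ, hi, by simp, by rintro τ ⟨⟩; exact hs⟩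
  · push Not at hs
    have hne : ∃ v : Fin n, v ≠ i := by
      have : t ≠ .C := by
        rintro rfl
        exact hs σ₀ (Or.inl (Set.mem_univ _))
      have hn2 : 2 ≤ n := hn (by cases t <;> simp_all)
      have := Fin.nontrivial_iff_two_le.2 hn2
      exact exists_ne i
    obtain ⟨v, hv⟩ := hne
    rcases hκ : κ v with σ | ⟨r, b⟩
    · exact absurd (Or.inr (Or.inl (mem_codeSigns.2 ⟨v, hκ⟩))) (hs σ)
    · have hr := h.canonical.mem_codeRoots hκ
      have hri : r ≠ i := by
        rintro rfl
        exact hs σ₀ (Or.inr (Or.inr (mem_codeNonsingletons.2 ⟨hi, v, hv, b, hκ⟩)))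
      rcases lt_or_gt_of_ne hri with hlt | hlt
      · exact ⟨i, .inr (r, false), hi, by rintro _ _ ⟨⟩; exact ⟨hlt, hr⟩, by simp⟩
      · exact ⟨r, .inr (i, false), hr, by rintro _ _ ⟨⟩; exact ⟨hlt, hi⟩, by simp⟩

lemma IsSubposetCode.covBy_top_iff (h : IsSubposetCode t σ₀ κ)
    (hn : t = .B ∨ t = .D → 2 ≤ n) : toSubposet t σ₀ κ ⋖ ⊤ ↔ codeRoots κ = ∅ := by
  constructor
  · intro hc
    by_contra hne
    obtain ⟨i, c, hm⟩ := h.exists_isMove hn (nonempty_iff_ne_empty.2 hne)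
    exact hc.2 (h.covBy_moveCode hm).1 (lt_top_iff_ne_top.2 (h.moveCode hm).toSubposet_ne_top)
  · intro he
    refine ⟨lt_top_iff_ne_top.2 h.toSubposet_ne_top, fun Z h1 h2 => ?_⟩
    obtain ⟨κ', h', rfl⟩ := exists_subposetCode h2.ne
    have := CodeLE.card_codeRoots_lt ((h.toSubposet_le_iff h').1 h1.le) h.canonical
      h'.canonical h'.admissible (by rw [Ne, ← h.toSubposet_inj h']; exact h1.ne)
    rw [he] at this
    simp at this

lemma IsSubposetCode.exists_of_covBy (h : IsSubposetCode t σ₀ κ) {Y : TypeSubposet n t σ₀}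
    (hY : Y ≠ ⊤) (hc : toSubposet t σ₀ κ ⋖ Y) :
    ∃ i c, IsMove (freeSigns t σ₀) κ i c ∧ Y = toSubposet t σ₀ (_root_.moveCode κ i c) := by
  obtain ⟨κ', h', rfl⟩ := exists_subposetCode hY
  have hle := (h.toSubposet_le_iff h').1 hc.le
  obtain ⟨i, c, hm, hc'⟩ := hle.exists_isMove h.canonical h'.canonical h'.admissible
    (by rw [Ne, ← h.toSubposet_inj h']; exact hc.ne)
  refine ⟨i, c, hm, ?_⟩
  have h1 := (h.moveCode hm).toSubposet_le_iff h' |>.2 (hle.moveCode_le hc')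
  rcases h1.eq_or_lt with h2 | h2
  · exact h2.symm
  · exact absurd h2 (hc.2 (h.covBy_moveCode hm).1)

end Subposet

/-! ### The recursion for decreasing chains. -/

section Chains

open Finset

variable {n : ℕ} {S : Type*} [Fintype S] [LinearOrder S] {t : PartitionType} {σ₀ : S}

/-- The list `c` continues `X` to a chain of covers that ends at the top, with weakly decreasing
labels of which the first is at most `ℓ`. -/
def IsDecreasingTail : ℕ ×ₗ ℕ → TypeSubposet n t σ₀ → List (TypeSubposet n t σ₀) → Prop
  | _, X, [] => X = ⊤
  | ℓ, X, Y :: c => X ⋖ Y ∧ edgeLabel X.1 Y.1 ≤ ℓ ∧ IsDecreasingTail (edgeLabel X.1 Y.1) Y c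

/-- The number of decreasing chains to the top with first label at most `ℓ`, from the element with
code function `κ`. -/
noncomputable def chainCount (t : PartitionType) (σ₀ : S) (ℓ : ℕ ×ₗ ℕ) (κ : Fin n → Code n S) :
    ℕ∞ := {c | IsDecreasingTail ℓ (toSubposet t σ₀ κ) c}.encard

lemma edgeLabel_top (X : LabeledPartitionPoset n S) : edgeLabel X ⊤ = toLex (1, 2) := by
  induction X using WithTop.recTopCoe <;> rfl

/-- The last label is always `(1, 2)`, so it bounds every earlier label from below. -/
lemma IsDecreasingTail.le_label {ℓ : ℕ ×ₗ ℕ} {X : TypeSubposet n t σ₀}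
    {c : List (TypeSubposet n t σ₀)} (h : IsDecreasingTail ℓ X c) (hX : X ≠ ⊤) :
    toLex (1, 2) ≤ ℓ := by
  induction c generalizing ℓ X with
  | nil => exact absurd h hX
  | cons Y c ih =>
    obtain ⟨h1, h2, h3⟩ := h
    by_cases hY : Y = ⊤
    · refine le_trans (le_of_eq ?_) h2
      subst hY
      exact (edgeLabel_top X.1).symm
    · exact (ih h3 hY).trans h2

lemma encard_biUnion_finset {ι α : Type*} (s : Finset ι) (f : ι → Set α)
    (h : ∀ i ∈ s, ∀ j ∈ s, i ≠ j → Disjoint (f i) (f j)) :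
    (⋃ i ∈ s, f i).encard = ∑ i ∈ s, (f i).encard := by
  classical
  induction s using Finset.induction_on with
  | empty => simp
  | insert a s ha ih =>
    rw [Finset.set_biUnion_insert, Set.encard_union_eq, sum_insert ha,
      ih fun i hi j hj => h i (Finset.mem_insert_of_mem hi) j (Finset.mem_insert_of_mem hj)]
    rw [Set.disjoint_iUnion₂_right]
    intro i hi
    exact h a (mem_insert_self _ _) i (mem_insert_of_mem hi) (by rintro rfl; exact ha hi)

/-- The label of a move; moves with small labels never occur in decreasing chains. -/
noncomputable def moveLabel (κ : Fin n → Code n S) : Code n S → ℕ ×ₗ ℕ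
  | .inl σ => toLex (1, codeLabel κ σ)
  | .inr (r, true) => toLex (2, (r : ℕ) + 1)
  | .inr (_, false) => toLex (0, 0)

variable {κ : Fin n → Code n S}

lemma IsSubposetCode.edgeLabel_moveCode (h : IsSubposetCode t σ₀ κ) {i : Fin n} {c : Code n S}
    (hm : IsMove (freeSigns t σ₀) κ i c) (hc : ∀ r, c ≠ .inr (r, false)) :
    edgeLabel (toSubposet t σ₀ κ).1 (toSubposet t σ₀ (_root_.moveCode κ i c)).1 =
      moveLabel κ c := by
  have h' := h.moveCode hm
  rw [h.toSubposet_val, h'.toSubposet_val]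
  rcases c with σ | ⟨r, _ | _⟩
  · exact h.encodes.edgeLabel_sign h'.encodes hm.1
  · exact absurd rfl (hc r)
  · exact h.encodes.edgeLabel_merge h'.encodes hm.1 (hm.2.1 _ _ rfl).2 (hm.2.1 _ _ rfl).1

lemma IsSubposetCode.chainCount_of_not_le (h : IsSubposetCode t σ₀ κ) {ℓ : ℕ ×ₗ ℕ}
    (hℓ : ¬ toLex (1, 2) ≤ ℓ) : chainCount t σ₀ ℓ κ = 0 := by
  rw [chainCount, Set.encard_eq_zero, Set.eq_empty_iff_forall_notMem]
  exact fun c hc => hℓ (IsDecreasingTail.le_label hc h.toSubposet_ne_top)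

lemma isDecreasingTail_top (ℓ : ℕ ×ₗ ℕ) (c : List (TypeSubposet n t σ₀)) :
    IsDecreasingTail ℓ ⊤ c ↔ c = [] := by
  cases c with
  | nil => simp [IsDecreasingTail]
  | cons Y c =>
    simp only [IsDecreasingTail, reduceCtorEq, iff_false, not_and]
    intro h
    exact absurd h.1 not_top_lt

lemma IsSubposetCode.chainCount_of_roots_eq_empty (h : IsSubposetCode t σ₀ κ)
    (hn : t = .B ∨ t = .D → 2 ≤ n) (hr : codeRoots κ = ∅) {ℓ : ℕ ×ₗ ℕ} (hℓ : toLex (1, 2) ≤ ℓ) :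
    chainCount t σ₀ ℓ κ = 1 := by
  rw [chainCount, Set.encard_eq_one]
  refine ⟨[⊤], ?_⟩
  ext c
  rw [Set.mem_ofPred_eq, Set.mem_singleton_iff]
  have hlab : edgeLabel (toSubposet t σ₀ κ).1 (⊤ : TypeSubposet n t σ₀).1 = toLex (1, 2) :=
    edgeLabel_top _
  constructor
  · intro hc
    cases c with
    | nil => exact absurd hc h.toSubposet_ne_top
    | cons Y c =>
      obtain ⟨h1, h2, h3⟩ := hc
      by_cases hY : Y = ⊤
      · subst hY
        rw [isDecreasingTail_top] at h3
        rw [h3]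
      · obtain ⟨i, c, hm, -⟩ := h.exists_of_covBy hY h1
        have := hm.1
        rw [hr] at this
        exact absurd this (notMem_empty _)
  · rintro rfl
    exact ⟨(h.covBy_top_iff hn).2 hr, hlab.trans_le hℓ, rfl⟩

open Classical in
lemma IsSubposetCode.chainCount_eq_sum (h : IsSubposetCode t σ₀ κ)
    (hn : t = .B ∨ t = .D → 2 ≤ n) (hr : (codeRoots κ).Nonempty) (ℓ : ℕ ×ₗ ℕ) :
    chainCount t σ₀ ℓ κ = ∑ i, ∑ c,
      if IsMove (freeSigns t σ₀) κ i c ∧ (∀ r, c ≠ .inr (r, false)) ∧ moveLabel κ c ≤ ℓ then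
        chainCount t σ₀ (moveLabel κ c) (_root_.moveCode κ i c) else 0 := by
  rw [← Fintype.sum_prod_type' (f := fun i c =>
    if IsMove (freeSigns t σ₀) κ i c ∧ (∀ r, c ≠ .inr (r, false)) ∧ moveLabel κ c ≤ ℓ then
        chainCount t σ₀ (moveLabel κ c) (_root_.moveCode κ i c) else 0), ← sum_filter]
  have key : {c | IsDecreasingTail ℓ (toSubposet t σ₀ κ) c} =
      ⋃ m ∈ univ.filter (fun m : Fin n × Code n S => IsMove (freeSigns t σ₀) κ m.1 m.2 ∧
        (∀ r, m.2 ≠ .inr (r, false)) ∧ moveLabel κ m.2 ≤ ℓ),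
        (fun c => toSubposet t σ₀ (_root_.moveCode κ m.1 m.2) :: c) ''
          {c | IsDecreasingTail (moveLabel κ m.2)
            (toSubposet t σ₀ (_root_.moveCode κ m.1 m.2)) c} := by
    ext c
    simp only [Set.mem_ofPred_eq, mem_filter, mem_univ, true_and, Set.mem_iUnion, Set.mem_image,
      exists_prop, Prod.exists]
    constructor
    · intro hc
      cases c with
      | nil => exact absurd hc h.toSubposet_ne_top
      | cons Y l =>
        obtain ⟨h1, h2, h3⟩ := hc
        have hY : Y ≠ ⊤ := by
          rintro rfl
          rw [h.covBy_top_iff hn] at h1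
          exact hr.ne_empty h1
        obtain ⟨i, c, hm, rfl⟩ := h.exists_of_covBy hY h1
        -- A coherent first edge has a label below `(1, 2)`, and a decreasing chain could not
        -- continue to the top.
        have hc : ∀ r, c ≠ .inr (r, false) := by
          rintro r rfl
          have h4 := h3.le_label hY
          rw [h.toSubposet_val, (h.moveCode hm).toSubposet_val] at h4
          exact h4.not_gt (h.encodes.edgeLabel_merge_false (h.moveCode hm).encodes hm.1
            (hm.2.1 _ _ rfl).2 (hm.2.1 _ _ rfl).1)
        rw [h.edgeLabel_moveCode hm hc] at h2 h3
        exact ⟨i, c, ⟨hm, hc, h2⟩, l, h3, rfl⟩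
    · rintro ⟨i, c, ⟨hm, hc, h2⟩, l, h3, rfl⟩
      rw [IsDecreasingTail, h.edgeLabel_moveCode hm hc]
      exact ⟨h.covBy_moveCode hm, h2, h3⟩
  rw [chainCount, key, encard_biUnion_finset]
  · refine sum_congr rfl fun m _ => ?_
    rw [(List.cons_injective).encard_image]
    rfl
  · rintro ⟨i, c⟩ hm ⟨j, d⟩ hm' hne
    rw [Set.disjoint_left]
    rintro _ ⟨l, -, rfl⟩ ⟨l', -, heq⟩
    simp only [mem_filter, mem_univ, true_and] at hm hm'
    have heq' := (List.cons_eq_cons.1 heq).1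
    rw [(h.moveCode hm'.1).toSubposet_inj (h.moveCode hm.1)] at heq'
    apply hne
    -- A move is determined by its result: `i` is the representative that disappears, and `c` is its
    -- new code.
    have h1 := codeRoots_moveCode hm.1.2.1
    rw [← heq', codeRoots_moveCode hm'.1.2.1] at h1
    have hij : i = j := by
      have : i ∉ (codeRoots κ).erase j := h1 ▸ notMem_erase i _
      by_contra hij
      exact this (mem_erase.2 ⟨hij, hm.1.1⟩)
    subst hij
    rw [← moveCode_self (c := c) hm.1.1, ← moveCode_self (c := d) hm.1.1, heq']

open Classical in
/-- A decreasing chain starts with a non-coherent merge or with a merge into a signed block. -/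
lemma IsSubposetCode.chainCount_eq (h : IsSubposetCode t σ₀ κ)
    (hn : t = .B ∨ t = .D → 2 ≤ n) (hr : (codeRoots κ).Nonempty) (ℓ : ℕ ×ₗ ℕ) :
    chainCount t σ₀ ℓ κ =
      (∑ r ∈ codeRoots κ, if toLex (2, (r : ℕ) + 1) ≤ ℓ then
        ∑ i ∈ codeRoots κ with r < i,
          chainCount t σ₀ (toLex (2, (r : ℕ) + 1)) (_root_.moveCode κ i (.inr (r, true))) else 0) +
      ∑ σ, if toLex (1, codeLabel κ σ) ≤ ℓ then
        ∑ i ∈ codeRoots κ with CanSign (freeSigns t σ₀) κ σ i,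
          chainCount t σ₀ (toLex (1, codeLabel κ σ)) (_root_.moveCode κ i (.inl σ)) else 0 := by
  rw [h.chainCount_eq_sum hn hr, sum_comm, Fintype.sum_sum_type, add_comm]
  congr 1
  · rw [Fintype.sum_prod_type]
    have hstep : ∀ r, (∑ b, ∑ i,
        if IsMove (freeSigns t σ₀) κ i (.inr (r, b)) ∧
          (∀ r', (.inr (r, b) : Code n S) ≠ .inr (r', false)) ∧ moveLabel κ (.inr (r, b)) ≤ ℓ then
        chainCount t σ₀ (moveLabel κ (.inr (r, b))) (_root_.moveCode κ i (.inr (r, b))) else 0) =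
        if r ∈ codeRoots κ then if toLex (2, (r : ℕ) + 1) ≤ ℓ then
        ∑ i ∈ codeRoots κ with r < i,
          chainCount t σ₀ (toLex (2, (r : ℕ) + 1)) (_root_.moveCode κ i (.inr (r, true))) else 0
        else 0 := by
      intro r
      have hmove : ∀ i, (IsMove (freeSigns t σ₀) κ i (.inr (r, true)) ∧
          (∀ r', (.inr (r, true) : Code n S) ≠ .inr (r', false)) ∧
          moveLabel κ (.inr (r, true)) ≤ ℓ) ↔
          (i ∈ codeRoots κ ∧ r < i) ∧ r ∈ codeRoots κ ∧ toLex (2, (r : ℕ) + 1) ≤ ℓ := by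
        intro i
        simp only [IsMove, Sum.inr.injEq, Prod.mk.injEq, moveLabel]
        constructor
        · rintro ⟨⟨h1, h2, -⟩, -, h3⟩
          exact ⟨⟨h1, (h2 _ _ ⟨rfl, rfl⟩).1⟩, (h2 _ _ ⟨rfl, rfl⟩).2, h3⟩
        · rintro ⟨⟨h1, h2⟩, h3, h4⟩
          refine ⟨⟨h1, ?_, by simp⟩, by simp, h4⟩
          rintro _ _ ⟨rfl, rfl⟩
          exact ⟨h2, h3⟩
      rw [Fintype.sum_bool]
      simp only [hmove]
      have h0 : ∀ i, ¬ (IsMove (freeSigns t σ₀) κ i (.inr (r, false)) ∧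
          (∀ r', (.inr (r, false) : Code n S) ≠ .inr (r', false)) ∧
          moveLabel κ (.inr (r, false)) ≤ ℓ) := fun i hi => hi.2.1 r rfl
      simp only [h0, if_false, sum_const_zero, add_zero]
      split_ifs with h1 h2
      · rw [← sum_filter]
        refine sum_congr ?_ fun i _ => rfl
        ext i
        simp [h1, h2]
      · simp [h2]
      · simp [h1]
    rw [sum_congr rfl fun r _ => hstep r, sum_ite_mem, univ_inter]
  · refine sum_congr rfl fun σ _ => ?_
    have hmove : ∀ i, (IsMove (freeSigns t σ₀) κ i (.inl σ) ∧
        (∀ r, (.inl σ : Code n S) ≠ .inr (r, false)) ∧ moveLabel κ (.inl σ) ≤ ℓ) ↔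
        (i ∈ codeRoots κ ∧ CanSign (freeSigns t σ₀) κ σ i) ∧ toLex (1, codeLabel κ σ) ≤ ℓ := by
      intro i
      simp [IsMove, moveLabel]
    simp only [hmove]
    split_ifs with hl
    · rw [← sum_filter]
      refine sum_congr ?_ fun i _ => rfl
      ext i
      simp [hl]
    · simp [hl]

end Chains

/-! ### Sign edges: block choices and words of ranks. -/

section SignPhase

open Finset

lemma sum_rank {α M : Type*} [LinearOrder α] [AddCommMonoid M] (T : Finset α) (g : ℕ → M) :
    ∑ σ ∈ T, g (T.filter (· ≤ σ)).card = ∑ b ∈ Icc 1 T.card, g b := by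
  induction T using Finset.induction_on_max with
  | empty => simp
  | insert m T hm ih =>
    have hmT : m ∉ T := fun h => (hm m h).false
    rw [sum_insert hmT, card_insert_of_notMem hmT, sum_Icc_succ_top (by omega), ← ih, add_comm]
    congr 1
    · refine sum_congr rfl fun σ hσ => ?_
      rw [filter_insert, if_neg (not_le.2 (hm σ hσ))]
    · rw [filter_true_of_mem, card_insert_of_notMem hmT]
      intro x hx
      rcases mem_insert.1 hx with rfl | hx
      · exact le_rfl
      · exact (hm x hx).le

/-- Nonempty sets are sorted by their maximum, which is the sign introduced first. -/
lemma sum_powerset_eq_sum_max {α M : Type*} [LinearOrder α] [AddCommMonoid M] (A : Finset α)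
    (g : Finset α → M) : ∑ R ∈ A.powerset, g R =
      g ∅ + ∑ σ ∈ A, ∑ R ∈ (A.filter (· < σ)).powerset, g (insert σ R) := by
  induction A using Finset.induction_on_max with
  | empty => simp
  | insert m A hm ih =>
    have hmA : m ∉ A := fun h => (hm m h).false
    rw [sum_powerset_insert hmA, ih, sum_insert hmA, add_assoc]
    congr 1
    rw [add_comm]
    congr 1
    · rw [filter_insert, if_neg (lt_irrefl m), filter_true_of_mem hm]
    · refine sum_congr rfl fun σ hσ => ?_
      rw [filter_insert, if_neg (not_lt.2 (hm σ hσ).le)]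

/-- The hockey-stick identity: weakly decreasing words of length `k + 1` in `{2, …, a}` are sorted
by their first letter `b`, leaving words of length `k` in `{2, …, b}`. -/
lemma sum_choose_of_le (k a t : ℕ) (ha : 1 ≤ a) (hat : a ≤ t) :
    ∑ b ∈ Icc 1 t, (if b ≤ a ∧ 2 ≤ b then (k + b - 2).choose k else 0) =
      (k + a - 1).choose (k + 1) := by
  have h1 : ∑ b ∈ Icc 1 t, (if b ≤ a ∧ 2 ≤ b then (k + b - 2).choose k else 0) =
      ∑ b ∈ Icc 2 a, (k + b - 2).choose k := by
    rw [← sum_filter]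
    refine sum_congr ?_ fun _ _ => rfl
    ext b
    simp only [mem_filter, mem_Icc]
    omega
  rw [h1]
  clear h1 hat
  induction a, ha using Nat.le_induction with
  | base => simp
  | succ a ha ih =>
    rw [sum_Icc_succ_top (by omega), ih, show k + (a + 1) - 2 = k + a - 1 by omega,
      show k + (a + 1) - 1 = k + a - 1 + 1 by omega, Nat.choose_succ_succ, add_comm]

lemma not_two_le_one (r a : ℕ) : ¬ (toLex (2, r) : ℕ ×ₗ ℕ) ≤ toLex (1, a) := by
  simp [Prod.Lex.toLex_le_toLex]

lemma toLex_one_le_iff (a b : ℕ) : (toLex (1, a) : ℕ ×ₗ ℕ) ≤ toLex (1, b) ↔ a ≤ b := by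
  simp [Prod.Lex.toLex_le_toLex]

variable {n : ℕ} {S : Type*} {κ : Fin n → Code n S}

lemma card_codeRoots_sign {i : Fin n} {σ : S} {k : ℕ} (hi : i ∈ codeRoots κ)
    (hk : (codeRoots κ).card = k + 1) : (codeRoots (moveCode κ i (.inl σ))).card = k := by
  have := card_codeRoots_moveCode (c := (.inl σ : Code n S)) hi (by simp)
  omega

open Classical in
/-- The number of ways to choose successively, from `k` blocks of which `s` are nonsingletons, the
first block for each sign in `R`, signs outside `F` requiring nonsingletons. -/
noncomputable def blockWays (F : Set S) (R : Finset S) (k s : ℕ) : ℕ :=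
  s.descFactorial (R.filter (· ∉ F)).card *
    (k - (R.filter (· ∉ F)).card).descFactorial (R.filter (· ∈ F)).card

lemma mul_descFactorial_pred (s e : ℕ) :
    s * (s - 1).descFactorial e = s.descFactorial (e + 1) := by
  cases s with
  | zero => simp
  | succ s => rw [Nat.succ_descFactorial_succ, Nat.add_sub_cancel]

lemma blockWays_insert_of_notMem [DecidableEq S] (F : Set S) {R : Finset S} {σ : S} (hR : σ ∉ R) (hσ : σ ∉ F)
    (k s : ℕ) : blockWays F (insert σ R) (k + 1) s = s * blockWays F R k (s - 1) := by
  classical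
  rw [blockWays, blockWays, filter_insert, if_pos hσ, filter_insert, if_neg hσ,
    card_insert_of_notMem (fun h => hR (mem_filter.1 h).1), ← mul_assoc, mul_descFactorial_pred,
    Nat.add_sub_add_right]

/-- The number of choices does not depend on the order of the signs, so a free sign may choose
first, among nonsingletons or singletons. -/
lemma blockWays_insert_of_mem [DecidableEq S] (F : Set S) {R : Finset S} {σ : S} (hR : σ ∉ R) (hσ : σ ∈ F)
    {k s : ℕ} (hs : s ≤ k + 1) : blockWays F (insert σ R) (k + 1) s =
      s * blockWays F R k (s - 1) + (k + 1 - s) * blockWays F R k s := by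
  classical
  rw [blockWays, blockWays, blockWays, filter_insert, if_neg (not_not.2 hσ), filter_insert,
    if_pos hσ, card_insert_of_notMem (fun h => hR (mem_filter.1 h).1)]
  generalize (R.filter (· ∉ F)).card = e
  generalize (R.filter (· ∈ F)).card = c
  rw [← mul_assoc, ← mul_assoc, mul_descFactorial_pred, ← add_mul, Nat.descFactorial_succ s e]
  rcases Nat.lt_or_ge s e with h | h
  · simp [Nat.descFactorial_of_lt h]
  · rw [← add_mul, show s - e + (k + 1 - s) = k + 1 - e by omega]
    rcases Nat.eq_or_lt_of_le (h.trans hs) with h' | h'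
    · subst h'
      simp
    · rw [show k + 1 - e = (k - e) + 1 by omega, Nat.succ_descFactorial_succ]
      ring

lemma blockWays_empty (F : Set S) (k s : ℕ) : blockWays F ∅ k s = 1 := by
  simp [blockWays]

lemma blockWays_zero (F : Set S) {R : Finset S} (hR : R.Nonempty) : blockWays F R 0 0 = 0 := by
  classical
  obtain ⟨σ, hσ⟩ := hR
  rw [blockWays, zero_tsub, mul_eq_zero, Nat.descFactorial_eq_zero_iff_lt,
    Nat.descFactorial_eq_zero_iff_lt, card_pos, card_pos]
  by_cases h : σ ∈ F
  · exact Or.inr ⟨σ, mem_filter.2 ⟨hσ, h⟩⟩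
  · exact Or.inl ⟨σ, mem_filter.2 ⟨hσ, h⟩⟩

lemma codeNonsingletons_subset : codeNonsingletons κ ⊆ codeRoots κ := fun _ h =>
  (mem_codeNonsingletons.1 h).1

variable [Fintype S]

lemma isMove_sign {F : Set S} {i : Fin n} {σ : S} (hi : i ∈ codeRoots κ) (hc : CanSign F κ σ i) :
    IsMove F κ i (.inl σ) :=
  ⟨hi, by simp, by rintro τ ⟨⟩; exact hc⟩

variable [LinearOrder S] {t : PartitionType} {σ₀ : S}

/-- This separates the labels of new signs from the ranks of present ones: after a present sign has
been used, no new sign can follow in a decreasing chain. -/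
lemma card_lt_codeLabel {σ : S} (hσ : σ ∉ codeSigns κ) : (codeSigns κ).card < codeLabel κ σ := by
  rw [codeLabel, if_neg hσ]
  refine card_lt_card ((ssubset_iff_of_subset subset_union_right).2 ⟨σ, ?_, hσ⟩)
  exact mem_union_left _ (by simp)

lemma codeLabel_of_mem {σ : S} (hσ : σ ∈ codeSigns κ) :
    codeLabel κ σ = ((codeSigns κ).filter (· ≤ σ)).card := if_pos hσ

lemma codeLabel_of_notMem {σ : S} (hσ : σ ∉ codeSigns κ) :
    codeLabel κ σ = ((univ.filter (· ≤ σ)) ∪ codeSigns κ).card := if_neg hσ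

lemma codeSigns_sign_of_mem {i : Fin n} {σ : S} (hi : i ∈ codeRoots κ) (hσ : σ ∈ codeSigns κ) :
    codeSigns (moveCode κ i (.inl σ)) = codeSigns κ := by
  rw [codeSigns_sign hi, insert_eq_of_mem hσ]

open Classical in
lemma IsSubposetCode.chainCount_one_eq (h : IsSubposetCode t σ₀ κ)
    (hn : t = .B ∨ t = .D → 2 ≤ n) (hr : (codeRoots κ).Nonempty) (a : ℕ) :
    chainCount t σ₀ (toLex (1, a)) κ = ∑ σ, if codeLabel κ σ ≤ a then
        ∑ i ∈ codeRoots κ with CanSign (freeSigns t σ₀) κ σ i,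
          chainCount t σ₀ (toLex (1, codeLabel κ σ)) (_root_.moveCode κ i (.inl σ)) else 0 := by
  rw [h.chainCount_eq hn hr]
  simp only [not_two_le_one, if_false, sum_const_zero, zero_add, toLex_one_le_iff]

/-- Once the labels are at most the number of signs, no new signs occur. -/
lemma IsSubposetCode.chainCount_of_le_card_signs (h : IsSubposetCode t σ₀ κ)
    (hn : t = .B ∨ t = .D → 2 ≤ n) {a : ℕ} (ha : 2 ≤ a) (hat : a ≤ (codeSigns κ).card) :
    chainCount t σ₀ (toLex (1, a)) κ = (((codeRoots κ).card.factorial *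
      ((codeRoots κ).card + a - 2).choose (codeRoots κ).card : ℕ) : ℕ∞) := by
  classical
  induction hk : (codeRoots κ).card generalizing κ a with
  | zero =>
    rw [h.chainCount_of_roots_eq_empty hn (card_eq_zero.1 hk) ((toLex_one_le_iff _ _).2 ha)]
    simp
  | succ k ih =>
    rw [h.chainCount_one_eq hn (card_pos.1 (by omega)) a]
    have hterm : ∀ σ, (if codeLabel κ σ ≤ a then
        ∑ i ∈ codeRoots κ with CanSign (freeSigns t σ₀) κ σ i,
          chainCount t σ₀ (toLex (1, codeLabel κ σ)) (_root_.moveCode κ i (.inl σ)) else 0) =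
        if σ ∈ codeSigns κ then (((k + 1) * (k.factorial *
          if codeLabel κ σ ≤ a ∧ 2 ≤ codeLabel κ σ then
            (k + codeLabel κ σ - 2).choose k else 0) : ℕ) : ℕ∞) else 0 := by
      intro σ
      by_cases hσ : σ ∈ codeSigns κ
      · rw [if_pos hσ]
        by_cases hl : codeLabel κ σ ≤ a
        · rw [if_pos hl]
          have hi : ∀ i ∈ (codeRoots κ).filter (fun i => CanSign (freeSigns t σ₀) κ σ i),
              chainCount t σ₀ (toLex (1, codeLabel κ σ)) (_root_.moveCode κ i (.inl σ)) =
              ((k.factorial * if codeLabel κ σ ≤ a ∧ 2 ≤ codeLabel κ σ then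
                (k + codeLabel κ σ - 2).choose k else 0 : ℕ) : ℕ∞) := by
            intro i hi
            obtain ⟨hi, hc⟩ := mem_filter.1 hi
            have h' := h.moveCode (isMove_sign hi hc)
            by_cases h2 : 2 ≤ codeLabel κ σ
            · rw [ih h' h2 (by rw [codeSigns_sign_of_mem hi hσ]; omega)
                (card_codeRoots_sign hi hk), if_pos ⟨hl, h2⟩]
            · rw [h'.chainCount_of_not_le (by rwa [toLex_one_le_iff]), if_neg (fun h => h2 h.2)]
              simp
          rw [sum_congr rfl hi, filter_true_of_mem (p := fun i => CanSign (freeSigns t σ₀) κ σ i)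
            (fun i _ => Or.inr (Or.inl hσ)), sum_const, hk]
          push_cast
          simp
        · rw [if_neg hl, if_neg (fun h => hl h.1)]
          simp
      · rw [if_neg hσ, if_neg]
        have := card_lt_codeLabel hσ
        omega
    -- The ranks of the present signs run once through `1, …, (codeSigns κ).card`, and every present
    -- sign accepts each of the `k + 1` blocks.
    rw [sum_congr rfl fun σ _ => hterm σ, sum_ite_mem, univ_inter, ← Nat.cast_sum]
    congr 1
    rw [sum_congr rfl fun σ hσ => by rw [codeLabel_of_mem hσ],
      sum_rank (codeSigns κ) (fun b => (k + 1) * (k.factorial *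
          if b ≤ a ∧ 2 ≤ b then (k + b - 2).choose k else 0)),
      ← mul_sum, ← mul_sum, sum_choose_of_le k a _ (by omega) hat, Nat.factorial_succ, mul_assoc,
      show k + 1 + a - 2 = k + a - 1 by omega]

open Classical in
lemma sum_blockWays (F : Set S) {R : Finset S} {σ : S} (hR : σ ∉ R) (hσ : σ ∉ codeSigns κ) {k : ℕ}
    (hk : (codeRoots κ).card = k + 1) :
    ∑ i ∈ codeRoots κ with CanSign F κ σ i,
      blockWays F R k (codeNonsingletons (moveCode κ i (.inl σ))).card =
      blockWays F (insert σ R) (k + 1) (codeNonsingletons κ).card := by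
  have hin : ∀ i ∈ codeNonsingletons κ,
      blockWays F R k (codeNonsingletons (moveCode κ i (.inl σ))).card =
      blockWays F R k ((codeNonsingletons κ).card - 1) := fun i hi => by
    rw [codeNonsingletons_sign, card_erase_of_mem hi]
  have hout : ∀ i ∈ codeRoots κ \ codeNonsingletons κ,
      blockWays F R k (codeNonsingletons (moveCode κ i (.inl σ))).card =
      blockWays F R k (codeNonsingletons κ).card := fun i hi => by
    rw [codeNonsingletons_sign, erase_eq_of_notMem (mem_sdiff.1 hi).2]
  by_cases hF : σ ∈ F
  · rw [filter_true_of_mem (p := fun i => CanSign F κ σ i) (fun i _ => Or.inl hF), blockWays_insert_of_mem F hR hF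
      (hk ▸ card_le_card codeNonsingletons_subset), ← sum_sdiff codeNonsingletons_subset,
      sum_congr rfl hin, sum_congr rfl hout, sum_const, sum_const,
      card_sdiff_of_subset codeNonsingletons_subset, hk, add_comm]
    simp
  · have : (codeRoots κ).filter (fun i => CanSign F κ σ i) = codeNonsingletons κ := by
      ext i
      simp only [mem_filter, CanSign, hF, hσ, false_or]
      exact ⟨fun h => h.2, fun h => ⟨codeNonsingletons_subset h, h⟩⟩
    rw [this, blockWays_insert_of_notMem F hR hF, sum_congr rfl hin, sum_const]
    simp

end SignPhase

/-! ### The total count for the sign phase. -/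

section SignPhaseTotal

open Finset

variable {S : Type*}

/-- The total number of ways to add the new signs `R` to `r` present signs and then to exhaust the
remaining blocks, when there are `k` blocks and `s` nonsingletons. -/
noncomputable def signWays (F : Set S) (R : Finset S) (r k s : ℕ) : ℕ :=
  blockWays F R k s * ((k - R.card).factorial * (k + r - 2).choose (k - R.card))

lemma signWays_zero (F : Set S) (A : Finset S) (r : ℕ) :
    ∑ R ∈ A.powerset, signWays F R r 0 0 = 1 := by
  rw [sum_eq_single ∅]
  · simp [signWays, blockWays_empty]
  · intro R _ hR
    simp [signWays, blockWays_zero F (nonempty_iff_ne_empty.2 hR)]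
  · simp

variable {n : ℕ} [Fintype S] [LinearOrder S] {t : PartitionType} {σ₀ : S} {κ : Fin n → Code n S}

lemma IsSubposetCode.chainCount_sign_of_mem (h : IsSubposetCode t σ₀ κ)
    (hn : t = .B ∨ t = .D → 2 ≤ n) {k : ℕ} (hk : (codeRoots κ).card = k + 1) {σ : S}
    (hσ : σ ∈ codeSigns κ) {i : Fin n} (hi : i ∈ codeRoots κ) :
    chainCount t σ₀ (toLex (1, codeLabel κ σ)) (_root_.moveCode κ i (.inl σ)) =
      ((k.factorial * if 2 ≤ codeLabel κ σ then (k + codeLabel κ σ - 2).choose k else 0 : ℕ) :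
        ℕ∞) := by
  have h' := h.moveCode (isMove_sign hi (Or.inr (Or.inl hσ)))
  have hle : codeLabel κ σ ≤ (codeSigns κ).card := by
    rw [codeLabel_of_mem hσ]
    exact card_le_card (filter_subset _ _)
  by_cases h2 : 2 ≤ codeLabel κ σ
  · rw [h'.chainCount_of_le_card_signs hn h2 (by rwa [codeSigns_sign_of_mem hi hσ]),
      card_codeRoots_sign hi hk, if_pos h2]
  · rw [h'.chainCount_of_not_le (by rwa [toLex_one_le_iff]), if_neg h2]
    simp

/-- With the label of the edge that introduced `τ` as the bound, the admissible new signs are those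
below `τ`: thus signs are introduced in decreasing order. -/
lemma codeLabel_le_of_isLeast {τ : S} (hτ : IsLeast (codeSigns κ : Set S) τ) (σ : S) :
    codeLabel κ σ ≤ ((univ.filter (· ≤ τ)) ∪ codeSigns κ).card ↔ σ ∈ codeSigns κ ∨ σ < τ := by
  by_cases hσ : σ ∈ codeSigns κ
  · simp only [hσ, true_or, iff_true]
    rw [codeLabel_of_mem hσ]
    exact card_le_card ((filter_subset _ _).trans subset_union_right)
  · simp only [hσ, false_or]
    rw [codeLabel_of_notMem hσ]
    constructor
    · intro hle
      by_contra hlt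
      have hlt' : τ < σ := lt_of_le_of_ne (not_lt.1 hlt) (by rintro rfl; exact hσ hτ.1)
      refine hle.not_gt (card_lt_card ((ssubset_iff_of_subset ?_).2 ⟨σ, ?_, ?_⟩))
      · refine union_subset_union_left fun x hx => ?_
        simp only [mem_filter, mem_univ, true_and] at hx ⊢
        exact hx.trans hlt'.le
      · exact mem_union_left _ (by simp)
      · rw [mem_union, not_or]
        exact ⟨by simpa using hlt', hσ⟩
    · intro hlt
      refine card_le_card (union_subset_union_left fun x hx => ?_)
      simp only [mem_filter, mem_univ, true_and] at hx ⊢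
      exact hx.trans hlt.le

lemma isLeast_codeSigns_sign {i : Fin n} {σ : S} (hi : i ∈ codeRoots κ)
    (hσ : ∀ τ ∈ codeSigns κ, σ < τ) :
    IsLeast (codeSigns (moveCode κ i (.inl σ)) : Set S) σ := by
  rw [codeSigns_sign hi]
  refine ⟨by simp, fun x hx => ?_⟩
  rcases mem_insert.1 (mem_coe.1 hx) with rfl | hx
  · exact le_rfl
  · exact (hσ x hx).le

lemma codeLabel_eq_card_sign {i : Fin n} {σ : S} (hi : i ∈ codeRoots κ) (hσ : σ ∉ codeSigns κ) :
    codeLabel κ σ =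
      ((univ.filter (· ≤ σ)) ∪ codeSigns (moveCode κ i (.inl σ))).card := by
  rw [codeLabel_of_notMem hσ, codeSigns_sign hi]
  congr 1
  ext x
  simp only [mem_union, mem_insert, mem_filter, mem_univ, true_and]
  constructor
  · rintro (h | h)
    · exact Or.inl h
    · exact Or.inr (Or.inr h)
  · rintro (h | rfl | h)
    · exact Or.inl h
    · exact Or.inl le_rfl
    · exact Or.inr h

open Classical in
lemma sum_signWays (F : Set S) {R : Finset S} {σ : S} (hR : σ ∉ R) (hσ : σ ∉ codeSigns κ) {k : ℕ}
    (hk : (codeRoots κ).card = k + 1) (r : ℕ) :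
    ∑ i ∈ codeRoots κ with CanSign F κ σ i,
      signWays F R (r + 1) k (codeNonsingletons (moveCode κ i (.inl σ))).card =
      signWays F (insert σ R) r (k + 1) (codeNonsingletons κ).card := by
  simp only [signWays]
  rw [← sum_mul, sum_blockWays F hR hσ hk, card_insert_of_notMem hR, Nat.add_sub_add_right,
    show k + (r + 1) - 2 = k + 1 + r - 2 by omega]

/-- The number of decreasing chains that start after the least sign has been introduced. -/
lemma IsSubposetCode.chainCount_of_isLeast (h : IsSubposetCode t σ₀ κ)
    (hn : t = .B ∨ t = .D → 2 ≤ n) {τ : S} (hτ : IsLeast (codeSigns κ : Set S) τ) {a : ℕ}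
    (ha : a = ((univ.filter (· ≤ τ)) ∪ codeSigns κ).card)
    (hka : (codeRoots κ).Nonempty ∨ 2 ≤ a) :
    chainCount t σ₀ (toLex (1, a)) κ =
      ((∑ R ∈ (univ.filter (· < τ)).powerset, signWays (freeSigns t σ₀) R (codeSigns κ).card
        (codeRoots κ).card (codeNonsingletons κ).card : ℕ) : ℕ∞) := by
  classical
  induction hk : (codeRoots κ).card generalizing κ τ a with
  | zero =>
    have he := card_eq_zero.1 hk
    have hs : (codeNonsingletons κ).card = 0 :=
      Nat.le_zero.1 (hk ▸ card_le_card codeNonsingletons_subset)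
    -- With no block left, the edge to the top requires `a ≥ 2`. The value `a = 1` occurs when the
    -- least sign of all is the only one present; it must then be excluded, as the formula would
    -- give 1.
    have h2 : 2 ≤ a := hka.resolve_left (by simp [he])
    rw [h.chainCount_of_roots_eq_empty hn he ((toLex_one_le_iff _ _).2 h2), hs, signWays_zero]
    simp
  | succ k ih =>
    rw [h.chainCount_one_eq hn (card_pos.1 (by omega)) a]
    have hτmem : τ ∈ codeSigns κ := hτ.1
    have htpos : 1 ≤ (codeSigns κ).card := card_pos.2 ⟨τ, hτmem⟩
    have hlt : ∀ {σ}, σ < τ → ∀ τ' ∈ codeSigns κ, σ < τ' := fun hσ τ' hτ' =>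
      hσ.trans_le (hτ.2 hτ')
    have hltn : ∀ {σ}, σ < τ → σ ∉ codeSigns κ := fun hσ h' => (hlt hσ _ h').false
    have hterm : ∀ σ, (if codeLabel κ σ ≤ a then
        ∑ i ∈ codeRoots κ with CanSign (freeSigns t σ₀) κ σ i,
          chainCount t σ₀ (toLex (1, codeLabel κ σ)) (_root_.moveCode κ i (.inl σ)) else 0) =
        (((if σ ∈ codeSigns κ then ((k + 1) * (k.factorial *
          if codeLabel κ σ ≤ (codeSigns κ).card ∧ 2 ≤ codeLabel κ σ then
            (k + codeLabel κ σ - 2).choose k else 0)) else 0) +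
        (if σ ∈ univ.filter (· < τ) then ∑ R ∈ (univ.filter (· < σ)).powerset,
          signWays (freeSigns t σ₀) (insert σ R) (codeSigns κ).card (k + 1)
            (codeNonsingletons κ).card else 0) : ℕ) : ℕ∞) := by
      intro σ
      have hle := codeLabel_le_of_isLeast hτ σ
      rw [← ha] at hle
      by_cases hσ : σ ∈ codeSigns κ
      · rw [if_pos (hle.2 (Or.inl hσ)), if_pos hσ, if_neg (show σ ∉ univ.filter (· < τ) from
          fun h' => hltn (mem_filter.1 h').2 hσ), add_zero]
        have hcard : codeLabel κ σ ≤ (codeSigns κ).card := by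
          rw [codeLabel_of_mem hσ]
          exact card_le_card (filter_subset _ _)
        rw [sum_congr rfl fun i hi =>
            h.chainCount_sign_of_mem hn hk hσ (mem_filter.1 hi).1,
          filter_true_of_mem (p := fun i => CanSign (freeSigns t σ₀) κ σ i)
            (fun i _ => Or.inr (Or.inl hσ)), sum_const, hk]
        simp only [hcard, true_and]
        push_cast
        simp
      · by_cases hστ : σ < τ
        · rw [if_pos (hle.2 (Or.inr hστ)), if_neg hσ, if_pos (by simpa using hστ), zero_add,
            sum_congr rfl fun R hR => (sum_signWays (freeSigns t σ₀) (fun hm => by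
              simpa using mem_powerset.1 hR hm) hσ hk (codeSigns κ).card).symm,
            sum_comm, Nat.cast_sum]
          refine sum_congr rfl fun i hi => ?_
          obtain ⟨hi, hc⟩ := mem_filter.1 hi
          rw [ih (h.moveCode (isMove_sign hi hc)) (isLeast_codeSigns_sign hi (hlt hστ))
            (codeLabel_eq_card_sign hi hσ) (Or.inr ?_) (card_codeRoots_sign hi hk),
            codeSigns_sign hi, card_insert_of_notMem hσ]
          have := card_lt_codeLabel hσ
          omega
        · rw [if_neg (fun h' => (hle.1 h').elim hσ hστ), if_neg hσ, if_neg (by simpa using hστ)]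
          simp
    -- Present signs contribute the summand `R = ∅`; a new sign `σ` contributes the sets `R` with
    -- maximum `σ`.
    rw [sum_congr rfl fun σ _ => hterm σ, ← Nat.cast_sum, sum_add_distrib, sum_ite_mem, univ_inter,
      sum_ite_mem, univ_inter, sum_powerset_eq_sum_max]
    congr 2
    · rw [sum_congr rfl fun σ hσ => by rw [codeLabel_of_mem hσ],
        sum_rank (codeSigns κ) (fun b => (k + 1) * (k.factorial *
          if b ≤ (codeSigns κ).card ∧ 2 ≤ b then (k + b - 2).choose k else 0)),
        ← mul_sum, ← mul_sum, sum_choose_of_le k _ _ htpos le_rfl, signWays, blockWays_empty,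
        one_mul, card_empty, Nat.sub_zero, Nat.factorial_succ, mul_assoc,
        show k + 1 + (codeSigns κ).card - 2 = k + (codeSigns κ).card - 1 by omega]
    · refine sum_congr rfl fun σ hσ => ?_
      have hστ : σ < τ := by simpa using hσ
      rw [filter_filter]
      refine sum_congr ?_ fun _ _ => rfl
      congr 1
      ext x
      simp only [mem_filter, mem_univ, true_and]
      exact ⟨fun h => ⟨h.trans hστ, h⟩, fun h => h.2⟩

open Classical in
/-- The number of decreasing ways to merge `k` blocks, `s` of which are nonsingletons, into signed
blocks, when there are no signs yet. -/
noncomputable def signPhaseCount (F : Set S) (k s : ℕ) : ℕ :=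
  if k = 1 then ∑ σ, if 2 ≤ (univ.filter (· ≤ σ)).card then (if σ ∈ F then 1 else s) else 0
  else ∑ R ∈ univ.powerset.erase ∅, signWays F R 0 k s

/-- The bound `(2, 0)` admits all sign edges and no non-coherent merge. The first sign edge reduces
the count to `chainCount_of_isLeast`, except for a single block, where the top follows at once and
the label must be at least `(1, 2)`. -/
lemma IsSubposetCode.chainCount_of_signs_eq_empty (h : IsSubposetCode t σ₀ κ)
    (hn : t = .B ∨ t = .D → 2 ≤ n) (hr : (codeRoots κ).Nonempty) (hs : codeSigns κ = ∅) :
    chainCount t σ₀ (toLex (2, 0)) κ =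
      (signPhaseCount (freeSigns t σ₀) (codeRoots κ).card (codeNonsingletons κ).card : ℕ∞) := by
  classical
  rw [h.chainCount_eq hn hr]
  have h1 : ∀ r : ℕ, ¬ (toLex (2, r + 1) : ℕ ×ₗ ℕ) ≤ toLex (2, 0) := by
    simp [Prod.Lex.toLex_le_toLex]
  have h2 : ∀ a : ℕ, (toLex (1, a) : ℕ ×ₗ ℕ) ≤ toLex (2, 0) := by
    simp [Prod.Lex.toLex_le_toLex]
  simp only [h1, h2, if_false, if_true, sum_const_zero, zero_add]
  obtain ⟨k, hk⟩ := Nat.exists_eq_add_of_le' (card_pos.2 hr)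
  have hnot : ∀ σ, σ ∉ codeSigns κ := by simp [hs]
  rw [signPhaseCount, hk]
  split_ifs with hk1
  · rw [Nat.cast_sum]
    refine sum_congr rfl fun σ _ => ?_
    have hlab : codeLabel κ σ = (univ.filter (· ≤ σ)).card := by
      rw [codeLabel_of_notMem (hnot σ), hs, union_empty]
    have hterm : ∀ i ∈ (codeRoots κ).filter (fun i => CanSign (freeSigns t σ₀) κ σ i),
        chainCount t σ₀ (toLex (1, codeLabel κ σ)) (_root_.moveCode κ i (.inl σ)) =
          ((if 2 ≤ (univ.filter (· ≤ σ)).card then 1 else 0 : ℕ) : ℕ∞) := by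
      intro i hi
      obtain ⟨hi, hc⟩ := mem_filter.1 hi
      have h' := h.moveCode (isMove_sign hi hc)
      have he : codeRoots (_root_.moveCode κ i (.inl σ)) = ∅ :=
        card_eq_zero.1 (card_codeRoots_sign hi (by omega))
      rw [hlab]
      split_ifs with h3
      · rw [h'.chainCount_of_roots_eq_empty hn he ((toLex_one_le_iff _ _).2 h3)]
        simp
      · rw [h'.chainCount_of_not_le (by rwa [toLex_one_le_iff])]
        simp
    have hcard : ((codeRoots κ).filter (fun i => CanSign (freeSigns t σ₀) κ σ i)).card =
        if σ ∈ freeSigns t σ₀ then 1 else (codeNonsingletons κ).card := by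
      split_ifs with hF
      · rw [filter_true_of_mem (p := fun i => CanSign (freeSigns t σ₀) κ σ i)
          (fun i _ => Or.inl hF), hk, hk1]
      · congr 1
        ext i
        simp only [mem_filter, CanSign, hF, hnot, false_or]
        exact ⟨fun h => h.2, fun h => ⟨codeNonsingletons_subset h, h⟩⟩
    rw [sum_congr rfl hterm, sum_const, hcard]
    split_ifs <;> simp
  · have hpow := sum_powerset_eq_sum_max (univ : Finset S) (fun R => if R = ∅ then 0 else
      signWays (freeSigns t σ₀) R 0 (k + 1) (codeNonsingletons κ).card)
    have hleft : ∑ R ∈ univ.powerset.erase ∅, signWays (freeSigns t σ₀) R 0 (k + 1)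
        (codeNonsingletons κ).card = ∑ R ∈ (univ : Finset S).powerset, if R = ∅ then 0 else
      signWays (freeSigns t σ₀) R 0 (k + 1) (codeNonsingletons κ).card := by
      rw [← add_sum_erase _ _ (empty_mem_powerset univ), if_pos rfl, zero_add]
      exact sum_congr rfl fun R hR => (if_neg (mem_erase.1 hR).1).symm
    rw [hleft, hpow, if_pos rfl, zero_add, Nat.cast_sum]
    refine sum_congr rfl fun σ _ => ?_
    rw [sum_congr rfl fun R hR => (if_neg (insert_ne_empty σ R)).trans
        (sum_signWays (freeSigns t σ₀) (fun hm => by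
          simpa using mem_powerset.1 hR hm) (hnot σ) hk 0).symm, sum_comm, Nat.cast_sum]
    refine sum_congr rfl fun i hi => ?_
    obtain ⟨hi, hc⟩ := mem_filter.1 hi
    have hcard := card_codeRoots_sign (σ := σ) hi hk
    rw [(h.moveCode (isMove_sign hi hc)).chainCount_of_isLeast hn
      (isLeast_codeSigns_sign hi (by simp [hs])) (codeLabel_eq_card_sign hi (hnot σ))
      (Or.inl (card_pos.1 (by omega))), hcard, codeSigns_sign hi, hs]
    simp

end SignPhaseTotal

/-! ### Non-coherent merges. -/

section MergePhase

open Finset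

/-- The extended natural number `x` is finite and its value, as an integer, is `z`. -/
def HasCount (x : ℕ∞) (z : ℤ) : Prop := ∃ N : ℕ, x = N ∧ (N : ℤ) = z

lemma HasCount.add {x y : ℕ∞} {z w : ℤ} (hx : HasCount x z) (hy : HasCount y w) :
    HasCount (x + y) (z + w) := by
  obtain ⟨a, rfl, rfl⟩ := hx
  obtain ⟨b, rfl, rfl⟩ := hy
  exact ⟨a + b, by push_cast; rfl, by push_cast; rfl⟩

lemma HasCount.sum {ι : Type*} (s : Finset ι) {x : ι → ℕ∞} {z : ι → ℤ}
    (h : ∀ i ∈ s, HasCount (x i) (z i)) : HasCount (∑ i ∈ s, x i) (∑ i ∈ s, z i) := by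
  classical
  induction s using Finset.induction_on with
  | empty => exact ⟨0, by simp, by simp⟩
  | insert a s ha ih =>
    rw [sum_insert ha, sum_insert ha]
    exact (h a (mem_insert_self _ _)).add (ih fun i hi => h i (mem_insert_of_mem hi))

lemma mergeOp_eq (f : ℕ → ℕ → ℤ) {l s : ℕ} (hs : s ≤ l) : mergeOp f l s =
    f (l + 1) (s + 1) + (s * mergeOp f (l - 1) (s - 1) + ((l : ℤ) - s) * mergeOp f (l - 1) s) := by
  cases l with
  | zero =>
    obtain rfl : s = 0 := by omega
    simp [mergeOp]
  | succ l =>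
    rw [mergeOp, Nat.add_sub_cancel]
    push_cast
    ring

variable {n : ℕ} {S : Type*} [Fintype S] {t : PartitionType} {σ₀ : S} {κ : Fin n → Code n S}

/-- There are no signs, and the first `q` elements are in singleton blocks. -/
structure IsFresh (t : PartitionType) (σ₀ : S) (q : ℕ) (κ : Fin n → Code n S) : Prop where
  isSubposetCode : IsSubposetCode t σ₀ κ
  signs_eq_empty : codeSigns κ = ∅
  mem_roots : ∀ v : Fin n, (v : ℕ) < q → v ∈ codeRoots κ
  notMem_nonsingletons : ∀ v : Fin n, (v : ℕ) < q → v ∉ codeNonsingletons κ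

lemma isMove_merge {F : Set S} {r i : Fin n} (hr : r ∈ codeRoots κ) (hi : i ∈ codeRoots κ)
    (hri : r < i) (b : Bool) : IsMove F κ i (.inr (r, b)) := by
  refine ⟨hi, ?_, by simp⟩
  rintro _ _ ⟨⟩
  exact ⟨hri, hr⟩

lemma IsFresh.merge {q : ℕ} (h : IsFresh t σ₀ q κ) {r i : Fin n} (hr : r ∈ codeRoots κ)
    (hi : i ∈ codeRoots κ) (hri : r < i) (hq : q ≤ r) :
    IsFresh t σ₀ q (moveCode κ i (.inr (r, true))) := by
  have hm := isMove_merge (F := freeSigns t σ₀) hr hi hri true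
  have hri' : (r : ℕ) < i := hri
  refine ⟨h.isSubposetCode.moveCode hm, ?_, fun v hv => ?_, fun v hv => ?_⟩
  · rw [codeSigns_merge, h.signs_eq_empty]
  · rw [codeRoots_moveCode hm.2.1, mem_erase]
    exact ⟨fun h' => by subst h'; omega, h.mem_roots v hv⟩
  · rw [codeNonsingletons_merge hi hri hr, mem_insert, mem_erase, not_or, not_and]
    exact ⟨fun h' => by subst h'; omega, fun _ => h.notMem_nonsingletons v hv⟩

lemma IsFresh.mono {q q' : ℕ} (h : IsFresh t σ₀ q κ) (hq : q' ≤ q) : IsFresh t σ₀ q' κ :=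
  ⟨h.isSubposetCode, h.signs_eq_empty, fun v hv => h.mem_roots v (by omega),
    fun v hv => h.notMem_nonsingletons v (by omega)⟩

lemma IsFresh.card_roots (h : IsFresh t σ₀ q κ) {r : Fin n} (hr : r ∈ codeRoots κ)
    (hq : (r : ℕ) = q) :
    (codeRoots κ).card = ((codeRoots κ).filter (r < ·)).card + (q + 1) := by
  rw [← card_filter_add_card_filter_not (s := codeRoots κ) (r < ·)]
  congr 1
  have : (codeRoots κ).filter (fun i => ¬ r < i) = Finset.Iic r := by
    ext v
    simp only [mem_filter, not_lt, mem_Iic]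
    refine ⟨fun h => h.2, fun hv => ⟨?_, hv⟩⟩
    rcases hv.eq_or_lt with rfl | hv
    · exact hr
    · exact h.mem_roots v (hq ▸ hv)
  rw [this, Fin.card_Iic, hq]

lemma IsFresh.nonsingletons_erase_subset (h : IsFresh t σ₀ q κ) {r : Fin n} (hq : (r : ℕ) = q) :
    (codeNonsingletons κ).erase r ⊆ (codeRoots κ).filter (r < ·) := by
  intro v hv
  obtain ⟨h1, h2⟩ := mem_erase.1 hv
  refine mem_filter.2 ⟨codeNonsingletons_subset h2, lt_of_le_of_ne ?_ h1.symm⟩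
  by_contra hlt
  exact h.notMem_nonsingletons v (hq ▸ not_le.1 hlt) h2

variable [LinearOrder S]

/-- Raising the bound from `(2, q)` to `(2, q + 1)` only adds the chains whose first edge has
exactly the new label, that is, merges the block of `r` with a later one. -/
lemma IsSubposetCode.chainCount_succ (h : IsSubposetCode t σ₀ κ)
    (hn : t = .B ∨ t = .D → 2 ≤ n) {q : ℕ} {r : Fin n} (hr : r ∈ codeRoots κ) (hq : (r : ℕ) = q) :
    chainCount t σ₀ (toLex (2, q + 1)) κ = chainCount t σ₀ (toLex (2, q)) κ +
      ∑ i ∈ codeRoots κ with r < i,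
        chainCount t σ₀ (toLex (2, q + 1)) (_root_.moveCode κ i (.inr (r, true))) := by
  classical
  rw [h.chainCount_eq hn ⟨r, hr⟩, h.chainCount_eq hn ⟨r, hr⟩, add_right_comm]
  have h1 : ∀ a b : ℕ, (toLex (1, a) : ℕ ×ₗ ℕ) ≤ toLex (2, b) := by
    simp [Prod.Lex.toLex_le_toLex]
  have h2 : ∀ a b : ℕ, (toLex (2, a) : ℕ ×ₗ ℕ) ≤ toLex (2, b) ↔ a ≤ b := by
    simp [Prod.Lex.toLex_le_toLex]
  simp only [h1, h2, if_true]
  congr 1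
  rw [← add_sum_erase _ _ hr, ← add_sum_erase (codeRoots κ) _ hr, if_pos (by omega),
    if_neg (by omega), zero_add, add_comm, hq]
  congr 1
  refine sum_congr rfl fun v hv => ?_
  have : (v : ℕ) ≠ q := fun h' => (mem_erase.1 hv).1 (Fin.ext (h'.trans hq.symm))
  congr 1
  simp only [eq_iff_iff]
  omega

/-- Absorbing `i` removes one later block, and one later nonsingleton exactly when the block of `i`
is nonsingleton; the sum is split accordingly. -/
lemma IsFresh.hasCount_sum_merge {q : ℕ} {f : ℕ → ℕ → ℤ} (h : IsFresh t σ₀ q κ) {r : Fin n}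
    (hr : r ∈ codeRoots κ) (hq : (r : ℕ) = q)
    (hi : ∀ i ∈ (codeRoots κ).filter (r < ·), HasCount
      (chainCount t σ₀ (toLex (2, q + 1)) (moveCode κ i (.inr (r, true))))
      (mergeOp f (((codeRoots (moveCode κ i (.inr (r, true)))).filter (r < ·)).card)
        ((codeNonsingletons (moveCode κ i (.inr (r, true)))).erase r).card)) :
    HasCount (∑ i ∈ codeRoots κ with r < i,
        chainCount t σ₀ (toLex (2, q + 1)) (moveCode κ i (.inr (r, true))))
      (((codeNonsingletons κ).erase r).card *
        mergeOp f (((codeRoots κ).filter (r < ·)).card - 1)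
          (((codeNonsingletons κ).erase r).card - 1) +
        ((((codeRoots κ).filter (r < ·)).card : ℤ) - ((codeNonsingletons κ).erase r).card) *
        mergeOp f (((codeRoots κ).filter (r < ·)).card - 1)
          ((codeNonsingletons κ).erase r).card) := by
  have hsub := h.nonsingletons_erase_subset hq
  convert HasCount.sum _ hi using 1
  have hl : ∀ i ∈ (codeRoots κ).filter (r < ·),
      (((codeRoots (moveCode κ i (.inr (r, true)))).filter (r < ·)).card) =
      ((codeRoots κ).filter (r < ·)).card - 1 := by
    intro i hi
    obtain ⟨h1, h2⟩ := mem_filter.1 hi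
    rw [codeRoots_moveCode (isMove_merge (F := freeSigns t σ₀) hr h1 h2 true).2.1, filter_erase,
      card_erase_of_mem hi]
  have hs : ∀ i ∈ (codeRoots κ).filter (r < ·),
      (codeNonsingletons (moveCode κ i (.inr (r, true)))).erase r =
      ((codeNonsingletons κ).erase r).erase i := by
    intro i hi
    obtain ⟨h1, h2⟩ := mem_filter.1 hi
    rw [codeNonsingletons_merge h1 h2 hr, erase_insert_eq_erase, erase_right_comm]
  rw [sum_congr rfl fun i hi => by rw [hl i hi, hs i hi], ← sum_sdiff hsub,
    sum_congr rfl fun i hi => by rw [erase_eq_of_notMem (mem_sdiff.1 hi).2], sum_const,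
    sum_congr rfl fun i hi => by rw [card_erase_of_mem hi], sum_const,
    card_sdiff_of_subset hsub, nsmul_eq_mul, nsmul_eq_mul, Nat.cast_sub (card_le_card hsub),
    add_comm]

/-- The merges of the block of `r` with later blocks. -/
lemma IsFresh.hasCount_mergeOp {q : ℕ} {f : ℕ → ℕ → ℤ} (h : IsFresh t σ₀ q κ)
    (hn : t = .B ∨ t = .D → 2 ≤ n)
    (hf : ∀ κ : Fin n → Code n S, IsFresh t σ₀ q κ → (codeRoots κ).Nonempty →
      HasCount (chainCount t σ₀ (toLex (2, q)) κ)
        (f ((codeRoots κ).card - q) (codeNonsingletons κ).card)) {r : Fin n}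
    (hr : r ∈ codeRoots κ) (hq : (r : ℕ) = q) (hrn : r ∈ codeNonsingletons κ) :
    HasCount (chainCount t σ₀ (toLex (2, q + 1)) κ)
      (mergeOp f ((codeRoots κ).filter (r < ·)).card ((codeNonsingletons κ).erase r).card) := by
  induction hl : ((codeRoots κ).filter (r < ·)).card generalizing κ with
  -- Both cases share the argument; for `zero` there is no later block, so the sum over merges is
  -- empty.
  | zero | succ l ih =>
    rw [h.isSubposetCode.chainCount_succ hn hr hq, ← hl,
      mergeOp_eq f (card_le_card (h.nonsingletons_erase_subset hq))]
    refine HasCount.add ?_ (h.hasCount_sum_merge hr hq fun i hi => ?_)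
    · convert hf κ h ⟨r, hr⟩ using 2
      · rw [h.card_roots hr hq]
        omega
      · rw [card_erase_add_one hrn]
    · first
      | exact absurd hi (by rw [card_eq_zero.1 hl]; exact notMem_empty _)
      | obtain ⟨h1, h2⟩ := mem_filter.1 hi
        have hm := isMove_merge (F := freeSigns t σ₀) hr h1 h2 true
        have hl' : ((codeRoots (moveCode κ i (.inr (r, true)))).filter (r < ·)).card = l := by
          rw [codeRoots_moveCode hm.2.1, filter_erase, card_erase_of_mem hi]
          omega
        rw [hl']
        refine ih (h.merge hr h1 h2 hq.ge) ?_ ?_ hl'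
        · rw [codeRoots_moveCode hm.2.1, mem_erase]
          exact ⟨h2.ne, hr⟩
        · rw [codeNonsingletons_merge h1 h2 hr]
          exact mem_insert_self _ _

/-- Induction over the stages: the representative with index `q` is still a singleton when its turn
comes, because blocks are only absorbed by smaller representatives, whose turn is later. -/
lemma IsFresh.hasCount_stagesOp {q : ℕ} (h : IsFresh t σ₀ q κ) (hn : t = .B ∨ t = .D → 2 ≤ n)
    (hqn : q ≤ n) (hr : (codeRoots κ).Nonempty) :
    HasCount (chainCount t σ₀ (toLex (2, q)) κ)
      (stagesOp (fun k s => (signPhaseCount (freeSigns t σ₀) k s : ℤ)) q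
        ((codeRoots κ).card - q) (codeNonsingletons κ).card) := by
  induction q generalizing κ with
  | zero =>
    exact ⟨_, h.isSubposetCode.chainCount_of_signs_eq_empty hn hr h.signs_eq_empty, rfl⟩
  | succ q ih =>
    set r : Fin n := ⟨q, hqn⟩ with hrdef
    have hq : (r : ℕ) = q := rfl
    have hrmem : r ∈ codeRoots κ := h.mem_roots r (by omega)
    have hrn : r ∉ codeNonsingletons κ := h.notMem_nonsingletons r (by omega)
    have h' := h.mono (Nat.le_succ q)
    have hcard := h'.card_roots hrmem hq
    have hle := card_le_card (h'.nonsingletons_erase_subset hq)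
    have ih' := fun (κ : Fin n → Code n S) (h : IsFresh t σ₀ q κ) (hr : (codeRoots κ).Nonempty) =>
      ih h (by omega) hr
    rw [stagesOp, stageOp, h'.isSubposetCode.chainCount_succ hn hrmem hq]
    have hl : (codeRoots κ).card - (q + 1) = ((codeRoots κ).filter (r < ·)).card := by omega
    have hl' : (codeRoots κ).card - q = ((codeRoots κ).filter (r < ·)).card + 1 := by omega
    rw [hl]
    have hsum := h'.hasCount_sum_merge (f := stagesOp (fun k s =>
      (signPhaseCount (freeSigns t σ₀) k s : ℤ)) q) hrmem hq fun i hi => by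
        obtain ⟨h1, h2⟩ := mem_filter.1 hi
        have hm := isMove_merge (F := freeSigns t σ₀) hrmem h1 h2 true
        refine (h'.merge hrmem h1 h2 hq.ge).hasCount_mergeOp hn ih' ?_ hq ?_
        · rw [codeRoots_moveCode hm.2.1, mem_erase]
          exact ⟨h2.ne, hrmem⟩
        · rw [codeNonsingletons_merge h1 h2 hrmem]
          exact mem_insert_self _ _
    have h0 := (ih' κ h' hr).add hsum
    rw [erase_eq_of_notMem hrn] at h0 hle
    convert h0 using 1
    -- If `r` absorbs nothing, its block remains a singleton; hence the term with `s + 1` inside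
    -- `mergeOp` is exchanged for one with `s`. After a first merge the block is nonsingleton and
    -- `mergeOp` is exact.
    rw [mergeOp_eq _ hle, hl']
    ring

end MergePhase

/-! ### Chains from the bottom element. -/

section Bottom

open Finset

variable {n : ℕ} {S : Type*} {t : PartitionType} {σ₀ : S}

lemma typeSubposet_bot_ne_top : (⊥ : TypeSubposet n t σ₀) ≠ ⊤ := fun h =>
  WithTop.coe_ne_top (a := (⊥ : SignedPartition n S)) (congrArg Subtype.val h)

/-- The code function of the partition into singletons. -/
def botCode (n : ℕ) (S : Type*) (v : Fin n) : Code n S := .inr (v, false)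

lemma codeRoots_botCode : codeRoots (botCode n S) = univ := by
  ext v; simp [mem_codeRoots, botCode]

lemma codeNonsingletons_botCode : codeNonsingletons (botCode n S) = ∅ := by
  ext v
  simp only [mem_codeNonsingletons, botCode, notMem_empty, iff_false, not_and, Sum.inr.injEq,
    Prod.mk.injEq]
  rintro - ⟨u, hu, b, h, -⟩
  exact hu h

variable [Fintype S]

lemma isFresh_botCode : IsFresh t σ₀ n (botCode n S) := by
  refine ⟨⟨?_, ?_⟩, ?_, ?_, ?_⟩
  · rintro v r b ⟨⟩
    exact ⟨le_rfl, rfl⟩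
  · rintro σ - v ⟨⟩
  · ext σ
    simp [mem_codeSigns, botCode]
  · simp [codeRoots_botCode]
  · simp [codeNonsingletons_botCode]

lemma toSubposet_botCode : toSubposet t σ₀ (botCode n S) = ⊥ := by
  have h := (isFresh_botCode (n := n) (t := t) (σ₀ := σ₀)).isSubposetCode
  obtain ⟨κ, hκ, hbot⟩ := exists_subposetCode (typeSubposet_bot_ne_top (t := t) (σ₀ := σ₀) (n := n))
  refine le_antisymm ?_ bot_le
  rw [hbot, h.toSubposet_le_iff hκ]
  intro v
  simp [botCode]

variable [LinearOrder S]

lemma labelWord_cons_cons (X Y : LabeledPartitionPoset n S) (c : List (LabeledPartitionPoset n S)) :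
    labelWord (X :: Y :: c) = edgeLabel X Y :: labelWord (Y :: c) := by
  simp [labelWord]

lemma isDecreasingTail_iff {ℓ : ℕ ×ₗ ℕ} {X : TypeSubposet n t σ₀}
    {c : List (TypeSubposet n t σ₀)} : IsDecreasingTail ℓ X c ↔
      (X :: c).getLast? = some ⊤ ∧ (X :: c).IsChain (· ⋖ ·) ∧
        (ℓ :: labelWord ((X :: c).map Subtype.val)).IsChain (· ≥ ·) := by
  induction c generalizing ℓ X with
  | nil => simp [IsDecreasingTail, labelWord]
  | cons Y c ih =>
    have hw : labelWord ((X :: Y :: c).map Subtype.val) =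
        edgeLabel X.1 Y.1 :: labelWord ((Y :: c).map Subtype.val) := labelWord_cons_cons _ _ _
    rw [IsDecreasingTail, ih, List.getLast?_cons_cons, List.isChain_cons_cons, hw,
      List.isChain_cons_cons]
    tauto

/-- The bound `(2, n)` is no restriction: the second component of a non-coherent label is an element
of `{1, …, n}`, and all other labels begin with 0 or 1. -/
lemma IsDecreasingTail.of_isChain_labelWord {X : TypeSubposet n t σ₀}
    {c : List (TypeSubposet n t σ₀)} (hX : X ≠ ⊤) (h1 : (X :: c).getLast? = some ⊤)
    (h2 : (X :: c).IsChain (· ⋖ ·))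
    (h3 : (labelWord ((X :: c).map Subtype.val)).IsChain (· ≥ ·)) :
    IsDecreasingTail (toLex (2, n)) X c := by
  cases c with
  | nil => exact absurd (by simpa using h1) hX
  | cons Y c =>
    have hw : labelWord ((X :: Y :: c).map Subtype.val) =
        edgeLabel X.1 Y.1 :: labelWord ((Y :: c).map Subtype.val) := labelWord_cons_cons _ _ _
    rw [hw] at h3
    rw [List.getLast?_cons_cons] at h1
    obtain ⟨h2, h2'⟩ := List.isChain_cons_cons.1 h2
    refine ⟨h2, ?_, isDecreasingTail_iff.2 ⟨h1, h2', h3⟩⟩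
    have hone : ∀ a : ℕ, (toLex (1, a) : ℕ ×ₗ ℕ) ≤ toLex (2, n) := by
      simp [Prod.Lex.toLex_le_toLex]
    by_cases hY : Y = ⊤
    · subst hY
      exact (edgeLabel_top X.1).trans_le (hone 2)
    · obtain ⟨κ, h, rfl⟩ := exists_subposetCode hX
      obtain ⟨i, c, hm, rfl⟩ := h.exists_of_covBy hY h2
      by_cases hc : ∀ r, c ≠ .inr (r, false)
      · rw [h.edgeLabel_moveCode hm hc]
        rcases c with σ | ⟨r, _ | _⟩
        · exact hone _
        · exact absurd rfl (hc r)
        · simp [moveLabel, Prod.Lex.toLex_le_toLex]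
      · push Not at hc
        obtain ⟨r, rfl⟩ := hc
        rw [h.toSubposet_val, (h.moveCode hm).toSubposet_val]
        exact (h.encodes.edgeLabel_merge_false (h.moveCode hm).encodes hm.1
          (hm.2.1 _ _ rfl).2 (hm.2.1 _ _ rfl).1).le.trans (hone 2)

lemma decreasingMaximalChains_eq : decreasingMaximalChains n t σ₀ =
    (fun c => ⊥ :: c) '' {c | IsDecreasingTail (toLex (2, n)) (⊥ : TypeSubposet n t σ₀) c} := by
  ext c
  constructor
  · rintro ⟨h1, h2, h3, h4⟩
    cases c with
    | nil => simp at h1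
    | cons X c =>
      obtain rfl : X = ⊥ := by simpa using h1
      exact ⟨c, IsDecreasingTail.of_isChain_labelWord typeSubposet_bot_ne_top h2 h3 h4, rfl⟩
  · rintro ⟨c, hc, rfl⟩
    obtain ⟨h1, h2, h3⟩ := isDecreasingTail_iff.1 hc
    exact ⟨rfl, h1, h2, h3.of_cons⟩

theorem encard_decreasingMaximalChains (hn : 1 ≤ n) (hBD : t = .B ∨ t = .D → 2 ≤ n) :
    (decreasingMaximalChains n t σ₀).encard =
      ((∑ π : Finpartition (univ : Finset (Fin n)),
        signPhaseCount (freeSigns t σ₀) π.parts.card π.nonsingletons.card *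
          π.doubleFactorialWeight : ℕ) : ℕ∞) := by
  have hne : (codeRoots (botCode n S)).Nonempty := by
    rw [codeRoots_botCode]
    exact ⟨⟨0, hn⟩, mem_univ _⟩
  have h := (isFresh_botCode (n := n) (t := t) (σ₀ := σ₀)).hasCount_stagesOp hBD le_rfl hne
  rw [codeRoots_botCode, codeNonsingletons_botCode, card_univ, Fintype.card_fin, Nat.sub_self,
    card_empty, chainCount, toSubposet_botCode] at h
  have h' := partitionSum_eq_stagesOp (univ : Finset (Fin n))
    (fun k s => (signPhaseCount (freeSigns t σ₀) k s : ℤ))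
  rw [card_univ, Fintype.card_fin] at h'
  obtain ⟨N, hN, hz⟩ := h
  rw [decreasingMaximalChains_eq, List.cons_injective.encard_image, hN]
  congr 1
  rw [← h', partitionSum] at hz
  exact_mod_cast hz

end Bottom

/-! ### Evaluation of the sign phase as the coefficient `f`. -/

section Coefficients

open Finset

lemma factorial_mul_choose_sub {k r : ℕ} (hr : 2 ≤ r) (hrk : r ≤ k) :
    (k - r).factorial * (k - 2).choose (k - r) = (k - 2).factorial / (r - 2).factorial := by
  refine (Nat.div_eq_of_eq_mul_left (Nat.factorial_pos _) ?_).symm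
  have := Nat.choose_mul_factorial_mul_factorial (show k - r ≤ k - 2 by omega)
  rw [show k - 2 - (k - r) = r - 2 by omega] at this
  rw [← this]
  ring

lemma choose_sub_eq_zero {k r : ℕ} (hr : r < 2) (hk : 2 ≤ k) : (k - 2).choose (k - r) = 0 :=
  Nat.choose_eq_zero_of_lt (by omega)

/-- Terms with `r < 2` vanish because of the binomial coefficient, those with `r > s` because of the
falling factorial. -/
lemma sum_signs_restricted {m k s : ℕ} (hk : 2 ≤ k) (hs : s ≤ k) :
    ∑ r ∈ range (m + 1), m.choose r * (s.descFactorial r *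
      ((k - r).factorial * (k - 2).choose (k - r))) =
    ∑ r ∈ Icc 2 (min m s), m.choose r * ((k - 2).factorial / (r - 2).factorial) *
      (s.factorial / (s - r).factorial) := by
  symm
  apply sum_subset_zero_on_sdiff
  · intro r hr
    simp only [mem_Icc, mem_range, le_min_iff] at hr ⊢
    omega
  · intro r hr
    simp only [mem_sdiff, mem_range, mem_Icc, le_min_iff] at hr
    rcases Nat.lt_or_ge r 2 with h | h
    · rw [choose_sub_eq_zero h hk]; simp
    · rw [Nat.descFactorial_of_lt (show s < r by omega)]; simp
  · intro r hr
    simp only [mem_Icc, le_min_iff] at hr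
    rw [factorial_mul_choose_sub hr.1 (by omega), Nat.descFactorial_eq_div hr.2.2]
    ring

/-- The sets `R` containing the distinguished sign: `e` counts the other signs, and `r = e + 1`. -/
lemma sum_signs_one_free {m k s : ℕ} (hk : 2 ≤ k) (hs : s ≤ k) :
    ∑ e ∈ range m, (m - 1).choose e * (s.descFactorial e * (k - e) *
      ((k - (e + 1)).factorial * (k - 2).choose (k - (e + 1)))) =
    ∑ r ∈ Icc 2 (min m (s + 1)), (m - 1).choose (r - 1) *
      ((k - 2).factorial / (r - 2).factorial) * (k + 1 - r) *
      (s.factorial / (s + 1 - r).factorial) := by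
  have hshift := sum_Ico_add' (fun r => (m - 1).choose (r - 1) * (s.descFactorial (r - 1) *
    (k - (r - 1)) * ((k - (r - 1 + 1)).factorial * (k - 2).choose (k - (r - 1 + 1))))) 0 m 1
  simp only [Nat.add_sub_cancel] at hshift
  rw [range_eq_Ico, hshift]
  symm
  apply sum_subset_zero_on_sdiff
  · intro r hr
    simp only [mem_Icc, mem_Ico, le_min_iff] at hr ⊢
    omega
  · intro r hr
    simp only [mem_sdiff, mem_Ico, mem_Icc, le_min_iff] at hr
    rcases Nat.lt_or_ge r 2 with h | h
    · rw [choose_sub_eq_zero (r := r - 1 + 1) (by omega) hk]; simp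
    · rw [Nat.descFactorial_of_lt (show s < r - 1 by omega)]; simp
  · intro r hr
    simp only [mem_Icc, le_min_iff] at hr
    rw [show k - (r - 1) = k + 1 - r by omega]
    -- The term `r = k + 1` occurs when `s = k`; its factor `k + 1 - r` is 0.
    rcases Nat.lt_or_ge k r with h | h
    · rw [show k + 1 - r = 0 by omega]; simp
    · rw [show r - 1 + 1 = r by omega, factorial_mul_choose_sub hr.1 h,
        Nat.descFactorial_eq_div (show r - 1 ≤ s by omega), show s - (r - 1) = s + 1 - r by omega]
      ring

/-- Vandermonde's identity, since `k.descFactorial r * (k - r)! = k!` for `r ≤ k`. -/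
lemma sum_signs_free (m k : ℕ) :
    ∑ r ∈ range (m + 1), m.choose r * (k.descFactorial r *
      ((k - r).factorial * (k - 2).choose (k - r))) = k.factorial * (m + (k - 2)).choose k := by
  rw [Nat.add_choose_eq, Nat.sum_antidiagonal_eq_sum_range_succ_mk, mul_sum]
  have h1 : ∀ r, m.choose r * (k.descFactorial r *
      ((k - r).factorial * (k - 2).choose (k - r))) =
      if r ≤ k then k.factorial * (m.choose r * (k - 2).choose (k - r)) else 0 := by
    intro r
    split_ifs with h
    · rw [← Nat.factorial_mul_descFactorial h]
      ring
    · rw [Nat.descFactorial_of_lt (by omega)]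
      simp
  rw [sum_congr rfl fun r _ => h1 r, ← sum_filter]
  refine sum_subset_zero_on_sdiff ?_ ?_ fun _ _ => rfl
  · intro r hr
    simp only [mem_filter, mem_range] at hr ⊢
    omega
  · intro r hr
    simp only [mem_sdiff, mem_filter, mem_range] at hr
    rw [Nat.choose_eq_zero_of_lt (show m < r by omega)]
    simp

variable {S : Type*} [Fintype S] [LinearOrder S]

/-- Either hypothesis lets the only block take any sign, and the condition on the label rules out
just the least one. -/
lemma signPhaseCount_one {F : Set S} {s : ℕ} (h : F = Set.univ ∨ s = 1) :
    signPhaseCount F 1 s = Fintype.card S - 1 := by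
  classical
  rw [signPhaseCount, if_pos rfl]
  have h1 : ∀ σ ∈ (univ : Finset S), (if 2 ≤ (univ.filter (· ≤ σ)).card then
      (if σ ∈ F then 1 else s) else 0) = if 2 ≤ (univ.filter (· ≤ σ)).card then 1 else 0 := by
    rintro σ -
    rcases h with rfl | rfl <;> simp
  rw [sum_congr rfl h1, sum_rank univ (fun b => if 2 ≤ b then 1 else 0), ← sum_filter, sum_const,
    smul_eq_mul, mul_one, card_univ]
  have : (Icc 1 (Fintype.card S)).filter (fun b => 2 ≤ b) = Icc 2 (Fintype.card S) := by
    ext b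
    simp only [mem_filter, mem_Icc]
    omega
  rw [this, Nat.card_Icc]
  omega

/-- For `k ≥ 2` the set `R = ∅` may be included, as `(k - 2).choose k = 0`. -/
lemma signPhaseCount_of_two_le (F : Set S) {k : ℕ} (s : ℕ) (hk : 2 ≤ k) :
    signPhaseCount F k s = ∑ R ∈ univ.powerset, blockWays F R k s *
      ((k - R.card).factorial * (k - 2).choose (k - R.card)) := by
  classical
  rw [signPhaseCount, if_neg (by omega), ← add_sum_erase _ _ (empty_mem_powerset univ), card_empty,
    choose_sub_eq_zero two_pos hk]
  simp [signWays]

lemma signPhaseCount_eq_chainCoeff (t : PartitionType) (σ₀ : S) {k s : ℕ} (hk : 1 ≤ k) (hs : s ≤ k)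
    (h1 : k = 1 → t = .B ∨ t = .D → s = 1) :
    signPhaseCount (freeSigns t σ₀) k s = chainCoeff t (Fintype.card S) k s := by
  classical
  have hm : 1 ≤ Fintype.card S := Fintype.card_pos_iff.2 ⟨σ₀⟩
  rcases Nat.eq_or_lt_of_le hk with rfl | hk2
  · rw [signPhaseCount_one]
    · cases t
      · simp [chainCoeff]
      · rw [chainCoeff]
        split_ifs with hm1
        · omega
        · obtain ⟨m, hm2⟩ := Nat.exists_eq_add_of_le' (show 2 ≤ Fintype.card S by omega)
          rw [hm2, show 1 + (m + 2) - 2 = m + 1 by omega, Nat.add_sub_cancel, Nat.factorial_succ,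
            Nat.mul_div_cancel _ (Nat.factorial_pos m)]
          omega
      · simp [chainCoeff]
    · cases t
      · exact Or.inr (h1 rfl (Or.inl rfl))
      · exact Or.inl rfl
      · exact Or.inr (h1 rfl (Or.inr rfl))
  · rw [signPhaseCount_of_two_le _ _ hk2]
    cases t
    · have hins : (univ : Finset S) = insert σ₀ (univ.erase σ₀) :=
        (insert_erase (mem_univ σ₀)).symm
      rw [hins, sum_powerset_insert (notMem_erase _ _)]
      have hR1 : ∀ R ∈ (univ.erase σ₀).powerset, blockWays (freeSigns .B σ₀) R k s =
          s.descFactorial R.card := by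
        intro R hR
        have : ∀ σ ∈ R, σ ≠ σ₀ := fun σ hσ => (mem_erase.1 (mem_powerset.1 hR hσ)).1
        rw [blockWays, filter_true_of_mem (by simpa [freeSigns] using this),
          filter_false_of_mem (by simpa [freeSigns] using this)]
        simp
      have hR2 : ∀ R ∈ (univ.erase σ₀).powerset, blockWays (freeSigns .B σ₀) (insert σ₀ R) k s *
          ((k - (insert σ₀ R).card).factorial * (k - 2).choose (k - (insert σ₀ R).card)) =
          s.descFactorial R.card * (k - R.card) *
          ((k - (R.card + 1)).factorial * (k - 2).choose (k - (R.card + 1))) := by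
        intro R hR
        have h2 : ∀ σ ∈ R, σ ≠ σ₀ := fun σ hσ => (mem_erase.1 (mem_powerset.1 hR hσ)).1
        have h3 : σ₀ ∉ R := fun h => h2 _ h rfl
        rw [blockWays, filter_insert, if_neg (by simp [freeSigns]), filter_insert,
          if_pos (by simp [freeSigns]), filter_true_of_mem (by simpa [freeSigns] using h2),
          filter_false_of_mem (by simpa [freeSigns] using h2), card_insert_of_notMem h3]
        simp
      rw [sum_congr rfl hR2, sum_congr rfl fun R hR => by rw [hR1 R hR],
        sum_powerset_apply_card (fun r => s.descFactorial r *
          ((k - r).factorial * (k - 2).choose (k - r))),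
        sum_powerset_apply_card (fun r => s.descFactorial r * (k - r) *
          ((k - (r + 1)).factorial * (k - 2).choose (k - (r + 1)))),
        card_erase_of_mem (mem_univ _), card_univ, Nat.sub_add_cancel hm]
      simp only [smul_eq_mul]
      rw [sum_signs_one_free hk2 hs]
      have := sum_signs_restricted (m := Fintype.card S - 1) hk2 hs
      rw [Nat.sub_add_cancel hm] at this
      rw [this, chainCoeff, if_neg (by omega), add_comm]
    · have hR : ∀ R ∈ (univ : Finset S).powerset, blockWays (freeSigns .C σ₀) R k s =
          k.descFactorial R.card := by
        intro R _
        rw [blockWays, filter_false_of_mem (by simp [freeSigns]),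
          filter_true_of_mem (by simp [freeSigns])]
        simp
      rw [sum_congr rfl fun R h => by rw [hR R h], sum_powerset_apply_card (fun r =>
        k.descFactorial r * ((k - r).factorial * (k - 2).choose (k - r))), card_univ]
      simp only [smul_eq_mul]
      rw [sum_signs_free, chainCoeff]
      split_ifs with hm1
      · rw [hm1, Nat.choose_eq_zero_of_lt (by omega), mul_zero]
      · refine (Nat.div_eq_of_eq_mul_left (Nat.factorial_pos _) ?_).symm
        have := Nat.choose_mul_factorial_mul_factorial
          (show k ≤ Fintype.card S + (k - 2) by omega)
        rw [show Fintype.card S + (k - 2) - k = Fintype.card S - 2 by omega,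
          show Fintype.card S + (k - 2) = k + Fintype.card S - 2 by omega] at this
        rw [← this, show Fintype.card S + (k - 2) = k + Fintype.card S - 2 by omega]
        ring
    · have hR : ∀ R ∈ (univ : Finset S).powerset, blockWays (freeSigns .D σ₀) R k s =
          s.descFactorial R.card := by
        intro R _
        rw [blockWays, filter_true_of_mem (by simp [freeSigns]),
          filter_false_of_mem (by simp [freeSigns])]
        simp
      rw [sum_congr rfl fun R h => by rw [hR R h], sum_powerset_apply_card (fun r =>
        s.descFactorial r * ((k - r).factorial * (k - 2).choose (k - r))), card_univ]
      simp only [smul_eq_mul]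
      rw [sum_signs_restricted hk2 hs, chainCoeff, if_neg (by omega)]

lemma Finpartition.nonsingletons_card_of_card_parts_eq_one {α : Type*} [DecidableEq α]
    {s : Finset α} (π : Finpartition s) (h : π.parts.card = 1) (hs : 2 ≤ s.card) :
    π.nonsingletons.card = 1 := by
  obtain ⟨P, hP⟩ := card_eq_one.1 h
  have hsum := π.sum_card_parts
  rw [hP, sum_singleton] at hsum
  rw [Finpartition.nonsingletons, hP, filter_singleton, if_pos (by omega), card_singleton]

end Coefficients

theorem mainTheorem4 {S : Type*} [Fintype S] [LinearOrder S] (σ₀ : S) (t : PartitionType) (n : ℕ)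
    (hn : 1 ≤ n) (hBD : t = PartitionType.B ∨ t = PartitionType.D → 2 ≤ n) :
    (decreasingMaximalChains n t σ₀).encard =
      ((∑ π : Finpartition (Finset.univ : Finset (Fin n)),
        chainCoeff t (Fintype.card S) π.parts.card
            (π.parts.filter (fun P => P.card ≠ 1)).card *
          ∏ P ∈ π.parts, Nat.doubleFactorial (2 * P.card - 3) : ℕ) : ℕ∞) := by
  rw [encard_decreasingMaximalChains hn hBD]
  congr 1
  refine Finset.sum_congr rfl fun π _ => ?_
  rw [signPhaseCount_eq_chainCoeff t σ₀]
  · rfl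
  · refine Finset.card_pos.2 (π.parts_nonempty ?_)
    exact (Finset.univ_nonempty_iff.2 ⟨⟨0, hn⟩⟩).ne_empty
  · exact Finset.card_le_card (Finset.filter_subset _ _)
  · intro hk ht
    exact π.nonsingletons_card_of_card_parts_eq_one hk (by simpa using hBD ht)
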